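/- Let $k$ be a field of characteristic $0$ and let $\beta\in k$ (for instance $k=\mathbb C(\beta)$ with $\beta$ an indeterminate). Free fermions. Let $\mathcal F$ be the fermionic Fock space (infinite wedge space) over $k$ with basis the vectors $v_{i_1}\wedge v_{i_2}\wedge\cdots$, where $i_1>i_2>\cdots$ are integers such that, for some $m\in\mathbb Z$, $i_j=-j+m$ for all large $j$. Let $\psi_n$ ($n\in\mathbb Z$) act by $v\mapsto v_n\wedge v$ and let $\psi_n^*$ be contraction with the coordinate form of $v_n$, so that $[\psi_m,\psi_n]_+=[\psi_m^*,\psi_n^*]_+=0$ and $[\psi_m,\psi_n^*]_+=\delta_{m,n}$. Put $|0\rangle=v_{-1}\wedge v_{-2}\wedge\cdots$ and $|{-r}\rangle=\psi^*_{-r}\cdots\psi^*_{-2}\psi^*_{-1}|0\rangle$ for $r\ge 0$, and let $\langle 0|v\rangle$ be the coefficient of $|0\rangle$ in $v$. Let $a_m=\sum_{i\in\mathbb Z}{:}\psi_i\psi^*_{i+m}{:}$ (normally ordered: the annihilation operators $\psi_i$, $i<0$, and $\psi_j^*$, $j\ge 0$, are moved to the right with the appropriate sign), and, with $p_m(x)=\sum_{i\ge1}x_i^m$,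 $$H(x)=\sum_{m\ge 1}\frac{p_m(x)}{m}\,a_m,\qquad \Theta=\sum_{m\ge1}\frac{(-1)^{m-1}\beta^m}{m}\,a_{-m}.$$ These operators and their exponentials act on the space of infinite formal linear combinations of the basis vectors with coefficients in $k[[x_1,x_2,\dots]]$, which is where the following expressions are evaluated. For a partition $\lambda=(\lambda_1\ge\cdots\ge\lambda_\ell>0)$ of length $\ell=\ell(\lambda)$, with $\lambda_i=0$ for $i>\ell$, and for $r\ge\ell$ define $$G^r_\lambda(x)=\langle 0|\,e^{H(x)}\,\psi_{\lambda_1-1}e^{\Theta}\,\psi_{\lambda_2-2}e^{\Theta}\cdots\psi_{\lambda_r-r}e^{\Theta}\,e^{-r\Theta}\,|{-r}\rangle\in k[[x_1,x_2,\dots]],$$ and for $n\ge\ell$ define the Grothendieck polynomial by the bialternant formula $$G_\lambda(x_1,\dots,x_n)=\frac{\det\left(x_i^{\lambda_j+n-j}(1+\beta x_i)^{j-1}\right)_{1\le i,j\le n}}{\prod_{1\le i<j\le n}(x_i-x_j)}.$$ Proposition. If $\ell(\lambda)\le n\le r$, then $G_\lambda(x_1,\dots,x_n)$ is a polynomial in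 $x_1,\dots,x_n$ over $k$, and $$G_\lambda(x_1,\dots,x_n)=G^r_\lambda(x_1,\dots,x_n,0,0,\dots).$$ -/

import Mathlib

noncomputable section

namespace FreeFermion

/-- Index set of the standard basis of the infinite wedge space. The strictly decreasing sequences
`i₁ > i₂ > ⋯` of integers with `i_k = -k + m` for `k ≫ 0` (some `m`) are encoded by their sets of
values `S = {i₁, i₂, …}`: finitely many nonnegative integers lie in `S` and finitely many negative
ones lie outside. The basis vector of `S` is `v_{i₁} ∧ v_{i₂} ∧ ⋯`. -/
def Maya : Type :=
  {S : Set ℤ // {i : ℤ | 0 ≤ i ∧ i ∈ S}.Finite ∧ {i : ℤ | i < 0 ∧ i ∉ S}.Finite}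

/-- `S ∪ {j}`. -/
def Maya.insert (j : ℤ) (S : Maya) : Maya :=
  ⟨Insert.insert j S.1,
    (S.2.1.union (Set.finite_singleton j)).subset (by
      rintro i ⟨h0, rfl | hi⟩
      · exact Or.inr rfl
      · exact Or.inl ⟨h0, hi⟩),
    S.2.2.subset (fun _ hi => ⟨hi.1, fun h => hi.2 (Or.inr h)⟩)⟩

/-- `S ∖ {j}`. -/
def Maya.erase (j : ℤ) (S : Maya) : Maya :=
  ⟨S.1 \ {j},
    S.2.1.subset (fun _ hi => ⟨hi.1, hi.2.1⟩),
    (S.2.2.union (Set.finite_singleton j)).subset (by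
      rintro i ⟨h0, hi⟩
      by_cases h : i ∈ S.1
      · exact Or.inr (by_contra fun hj => hi ⟨h, hj⟩)
      · exact Or.inl ⟨h0, h⟩)⟩

/-- The vacuum `v_{-1} ∧ v_{-2} ∧ v_{-3} ∧ ⋯`. -/
def Maya.vacuum : Maya :=
  ⟨{i : ℤ | i < 0},
    Set.finite_empty.subset (fun _ hi => absurd hi.2 (not_lt.mpr hi.1)),
    Set.finite_empty.subset (fun _ hi => hi.2 hi.1)⟩

/-- The sign `(-1)^{#{i ∈ S : i > j}}` of moving `v_j` past the factors of larger index. -/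
def Maya.sign (j : ℤ) (S : Maya) : ℤ :=
  (-1) ^ {i : ℤ | i ∈ S.1 ∧ j < i}.ncard

/-- The fermionic Fock space with coefficients in `k⟦x₁, x₂, …⟧` (the variable `x_{i+1}` is the
one with index `i : ℕ`), completed so that infinite formal combinations of basis vectors are
allowed: `v : Fock k` stands for `∑_S v(S) · v_S`. The operators `e^Θ` do not preserve the space of
finite combinations, but act on this completion. -/
abbrev Fock (k : Type*) : Type _ := Maya → MvPowerSeries ℕ k

variable {k : Type*} [Field k]

/-- The sum of a family of vectors, computed separately for the coefficient of each basis vector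
and each monomial in the `x_i`. All sums formed below are finite for each such coefficient. -/
def formalSum {ι : Type*} (f : ι → Fock k) : Fock k :=
  fun S d => ∑ᶠ i, MvPowerSeries.coeff d (f i S)

open Classical in
/-- The fermion `ψ_j`: `v_S ↦ v_j ∧ v_S`. -/
def psi (j : ℤ) (v : Fock k) : Fock k :=
  fun S => if j ∈ S.1 then (S.erase j).sign j • v (S.erase j) else 0

open Classical in
/-- The fermion `ψ*_j`: contraction with the coordinate form of `v_j`. -/
def psiStar (j : ℤ) (v : Fock k) : Fock k :=
  fun S => if j ∈ S.1 then 0 else S.sign j • v (S.insert j)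

/-- The normally ordered product `:ψ_i ψ*_j:`, with annihilation operators (`ψ_i` for `i < 0` and
`ψ*_j` for `j ≥ 0`) moved to the right. -/
def normalOrdered (i j : ℤ) (v : Fock k) : Fock k :=
  if i < 0 then -psiStar j (psi i v) else psi i (psiStar j v)

/-- The current operator `a_m = ∑_{i ∈ ℤ} :ψ_i ψ*_{i+m}:`. -/
def current (m : ℤ) (v : Fock k) : Fock k :=
  formalSum fun i : ℤ => normalOrdered i (i + m) v

/-- The exponential `e^T = ∑_j T^j / j!` of an operator. -/
def expOp (T : Fock k → Fock k) (v : Fock k) : Fock k :=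
  formalSum fun j : ℕ => ((j.factorial : k)⁻¹) • T^[j] v

open Classical in
/-- The power sum `p_m(x) = x₁^m + x₂^m + ⋯` (for `m > 0`). -/
def powerSum (m : ℕ) : MvPowerSeries ℕ k :=
  fun d => if ∃ i : ℕ, d = Finsupp.single i m then 1 else 0

/-- `H(x) = ∑_{m > 0} (p_m(x) / m) a_m`. -/
def opH (v : Fock k) : Fock k :=
  formalSum fun m : ℕ =>
    (((m + 1 : ℕ) : k)⁻¹ • powerSum (k := k) (m + 1)) • current ((m : ℤ) + 1) v

/-- `Θ = β a_{-1} - (β²/2) a_{-2} + (β³/3) a_{-3} - ⋯`. -/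
def opTheta (β : k) (v : Fock k) : Fock k :=
  formalSum fun m : ℕ =>
    ((-1) ^ m * β ^ (m + 1) / ((m + 1 : ℕ) : k)) • current (-((m : ℤ) + 1)) v

/-- `e^{sΘ}`. -/
def expTheta (β : k) (s : ℤ) : Fock k → Fock k :=
  expOp fun v => (s : k) • opTheta β v

open Classical in
/-- The vacuum vector `|0⟩`. -/
def vacuum : Fock k := fun S => if S = Maya.vacuum then 1 else 0

/-- The shifted vacuum `|-r⟩ = ψ*_{-r} ⋯ ψ*_{-2} ψ*_{-1} |0⟩`. -/
def shiftedVacuum : ℕ → Fock k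
  | 0 => vacuum
  | r + 1 => psiStar (-((r : ℤ) + 1)) (shiftedVacuum r)

/-- The pairing `⟨0|v⟩`: the basis vectors being orthonormal, it is the coefficient of the
vacuum. -/
def vacuumPairing (v : Fock k) : MvPowerSeries ℕ k := v Maya.vacuum

/-- `G^r_λ(x) = ⟨0| e^{H(x)} ψ_{λ₁-1} e^Θ ψ_{λ₂-2} e^Θ ⋯ ψ_{λ_r-r} e^Θ · e^{-rΘ} |-r⟩`.
Here `lam.rowLen i` is the part `λ_{i+1}`, equal to `0` beyond the length of `λ`. -/
def fermionicG (β : k) (lam : YoungDiagram) (r : ℕ) : MvPowerSeries ℕ k :=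
  vacuumPairing (expOp opH
    ((List.range r).foldr
      (fun i v => psi ((lam.rowLen i : ℤ) - ((i : ℤ) + 1)) (expTheta β 1 v))
      (expTheta β (-(r : ℤ)) (shiftedVacuum r))))

/-- The specialization `f(x₁, …, x_n, 0, 0, …)` of a power series in `x₁, x₂, …`. -/
def specialize (n : ℕ) (f : MvPowerSeries ℕ k) : MvPowerSeries (Fin n) k :=
  MvPowerSeries.killCompl Fin.valEmbedding f

/-- The bialternant formula for the Grothendieck polynomial `G_λ(x₁, …, x_n)`, a ratio in the field
of fractions of `k[x₁, …, x_n]`: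
`det (x_i^{λ_j+n-j} (1 + β x_i)^{j-1})_{1 ≤ i,j ≤ n} / ∏_{1 ≤ i < j ≤ n} (x_i - x_j)`.
Indices are shifted to start from `0`. -/
def bialternantG (β : k) (lam : YoungDiagram) (n : ℕ) : FractionRing (MvPolynomial (Fin n) k) :=
  algebraMap (MvPolynomial (Fin n) k) (FractionRing (MvPolynomial (Fin n) k))
      (Matrix.det (Matrix.of fun i j : Fin n =>
        (MvPolynomial.X i : MvPolynomial (Fin n) k) ^ (lam.rowLen j + (n - (j + 1))) *
          (1 + MvPolynomial.C β * MvPolynomial.X i) ^ (j : ℕ))) /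
    algebraMap (MvPolynomial (Fin n) k) (FractionRing (MvPolynomial (Fin n) k))
      (∏ i : Fin n, ∏ j ∈ Finset.Ioi i, (MvPolynomial.X i - MvPolynomial.X j))

end FreeFermion

end

/-! The Fock space computation reduces to finite sums for two reasons. `opH` lowers the energy, so
it acts locally nilpotently on finite vectors. `opTheta` raises the energy and leaves the finite
vectors, but it is the transpose of an operator of the same lowering kind. What is needed is
conjugation of fermions by exponentials of lowering operators (`locExp_seriesAction`): if [L, φ_n] =
∑ c_l φ_{n+l}, then e^L multiplies the generating series of the φ_n by e^{c(z)}.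

For Θ the factor is exp(log(1 + βz)) = 1 + βz. Pushing e^{-iΘ} to the left through the fermion in
position i (counted from 0) replaces v_n by (1 + βσ)^i v_n, where σ is the shift v_m ↦ v_{m+1}; the
factors e^Θ use up e^{-rΘ} exactly (`foldr_psi_expTheta`), and a finite vector remains. For H the
factor is h(z) = ∑ h_m z^m, and H kills |-r⟩. Wick's theorem (`vacuumExpectation_eq_det`) then gives
a determinant of Jacobi–Trudi type, of size r, with entries ∑_m binom(i,m) β^m h_{λ_i-i+j+m}
(`fermionicG_eq_det`).

In finitely many variables h(z) ∏(1 - x_i z) = 1. Multiplying the matrix by that of the coefficients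
of the products ∏_{i≠l}(1 - x_i z) collapses its entries to those of the bialternant numerator, and
the second factor has the Vandermonde product as determinant (`jacobiTrudiDet_mul_vandermonde`). The
size drops from r to n because a variable 0 matched with a part 0 multiplies numerator and
Vandermonde product by the same ∏ x_i (`jacobiTrudiDet_succ_generic`). The determinant of size n has
polynomial entries, hence polynomiality. -/

noncomputable section

namespace FreeFermion

/-! ### Maya diagrams: signs and energy -/

namespace Maya

theorem ext {S T : Maya} (h : ∀ i, i ∈ S.1 ↔ i ∈ T.1) : S = T :=
  Subtype.ext (Set.ext h)

@[simp] theorem mem_insert {i j : ℤ} {S : Maya} : i ∈ (S.insert j).1 ↔ i = j ∨ i ∈ S.1 := Iff.rfl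

@[simp] theorem mem_erase {i j : ℤ} {S : Maya} : i ∈ (S.erase j).1 ↔ i ∈ S.1 ∧ i ≠ j := Iff.rfl

theorem insert_erase {j : ℤ} {S : Maya} (h : j ∈ S.1) : (S.erase j).insert j = S :=
  ext fun i => by by_cases hi : i = j <;> simp [hi, h]

theorem erase_insert {j : ℤ} {S : Maya} (h : j ∉ S.1) : (S.insert j).erase j = S :=
  ext fun i => by by_cases hi : i = j <;> simp [hi, h]

theorem insert_comm (i j : ℤ) (S : Maya) : (S.insert i).insert j = (S.insert j).insert i :=
  ext fun l => by simp only [mem_insert]; tauto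

theorem exists_le_of_mem (S : Maya) : ∃ a : ℤ, ∀ i ∈ S.1, i ≤ a := by
  obtain ⟨a, ha⟩ := S.2.1.bddAbove
  refine ⟨max a 0, fun i hi => ?_⟩
  rcases le_or_gt 0 i with h | h
  · exact le_max_of_le_left (ha ⟨h, hi⟩)
  · exact le_max_of_le_right h.le

theorem exists_ge_of_notMem (S : Maya) : ∃ b : ℤ, ∀ i, i ∉ S.1 → b ≤ i := by
  obtain ⟨b, hb⟩ := S.2.2.bddBelow
  refine ⟨min b 0, fun i hi => ?_⟩
  rcases lt_or_ge i 0 with h | h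
  · exact min_le_of_left_le (hb ⟨h, hi⟩)
  · exact min_le_of_right_le h

theorem finite_mem_gt (S : Maya) (j : ℤ) : {i : ℤ | i ∈ S.1 ∧ j < i}.Finite := by
  obtain ⟨a, ha⟩ := S.exists_le_of_mem
  exact (Set.finite_Icc j a).subset fun i hi => ⟨hi.2.le, ha i hi.1⟩

theorem sign_mul_self (j : ℤ) (S : Maya) : S.sign j * S.sign j = 1 := by
  simp [sign, ← mul_pow]

theorem sign_insert_of_lt {i j : ℤ} {S : Maya} (hi : i ∉ S.1) (h : j < i) :
    (S.insert i).sign j = -S.sign j := by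
  have : {l : ℤ | l ∈ (S.insert i).1 ∧ j < l} = Insert.insert i {l : ℤ | l ∈ S.1 ∧ j < l} := by
    ext l
    simp only [mem_insert, Set.mem_ofPred_eq, Set.mem_insert_iff]
    grind
  rw [sign, this, Set.ncard_insert_of_notMem (fun h' => hi h'.1) (S.finite_mem_gt j), pow_succ,
    sign, mul_neg_one]

theorem sign_insert_of_le {i j : ℤ} {S : Maya} (h : i ≤ j) : (S.insert i).sign j = S.sign j := by
  have : {l : ℤ | l ∈ (S.insert i).1 ∧ j < l} = {l : ℤ | l ∈ S.1 ∧ j < l} := by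
    ext l
    simp only [mem_insert, Set.mem_ofPred_eq]
    grind
  rw [sign, this, sign]

/-- Inserting two distinct new elements in the two possible orders gives opposite signs. -/
theorem sign_mul_sign_insert {i j : ℤ} {S : Maya} (hij : i ≠ j) (hi : i ∉ S.1) (hj : j ∉ S.1) :
    S.sign j * (S.insert j).sign i = -(S.sign i * (S.insert i).sign j) := by
  rcases lt_or_gt_of_ne hij with h | h
  · rw [sign_insert_of_lt hj h, sign_insert_of_le h.le]; ring
  · rw [sign_insert_of_le h.le, sign_insert_of_lt hi h]; ring

/-- The part of the energy coming from the occupied nonnegative sites and the empty negative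
sites. -/
def energy (S : Maya) : ℤ :=
  (∑ᶠ i ∈ {i : ℤ | 0 ≤ i ∧ i ∈ S.1}, i) - ∑ᶠ i ∈ {i : ℤ | i < 0 ∧ i ∉ S.1}, i

theorem energy_nonneg (S : Maya) : 0 ≤ S.energy := by
  have h1 : 0 ≤ ∑ᶠ i ∈ {i : ℤ | 0 ≤ i ∧ i ∈ S.1}, i :=
    finsum_nonneg fun i => finsum_nonneg fun hi => hi.1
  have h2 : 0 ≤ ∑ᶠ i ∈ {i : ℤ | i < 0 ∧ i ∉ S.1}, -i :=
    finsum_nonneg fun i => finsum_nonneg fun hi => by have := hi.1; omega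
  rw [finsum_mem_neg_distrib _ S.2.2] at h2
  rw [energy]; linarith

/-- A negative `j` leaves the subtracted sum over empty sites, so both signs of `j` obey the same
rule. Consequently moving a particle changes the energy by its displacement. -/
theorem energy_insert {j : ℤ} {S : Maya} (hj : j ∉ S.1) :
    (S.insert j).energy = S.energy + j := by
  unfold energy
  rcases le_or_gt 0 j with h | h
  · have h1 : {i : ℤ | 0 ≤ i ∧ i ∈ (S.insert j).1} = Insert.insert j {i : ℤ | 0 ≤ i ∧ i ∈ S.1} := by
      ext i; simp only [mem_insert, Set.mem_ofPred_eq, Set.mem_insert_iff]; grind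
    have h2 : {i : ℤ | i < 0 ∧ i ∉ (S.insert j).1} = {i : ℤ | i < 0 ∧ i ∉ S.1} := by
      ext i; simp only [mem_insert, Set.mem_ofPred_eq]; grind
    rw [h1, h2, finsum_mem_insert _ (fun h' => hj h'.2) S.2.1]; ring
  · have h1 : {i : ℤ | 0 ≤ i ∧ i ∈ (S.insert j).1} = {i : ℤ | 0 ≤ i ∧ i ∈ S.1} := by
      ext i; simp only [mem_insert, Set.mem_ofPred_eq]; grind
    have h2 : {i : ℤ | i < 0 ∧ i ∉ S.1} =
        Insert.insert j {i : ℤ | i < 0 ∧ i ∉ (S.insert j).1} := by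
      ext i; simp only [mem_insert, Set.mem_ofPred_eq, Set.mem_insert_iff]; grind
    rw [h1, h2, finsum_mem_insert _ (fun h' => h'.2 (Or.inl rfl)) (S.insert j).2.2]; ring

end Maya

/-- Finite linear combinations of the basis vectors of the infinite wedge space. -/
abbrev FinFock (R : Type*) [CommRing R] : Type _ := Maya →₀ R

/-! ### Fermions on finite vectors and their anticommutation relations -/

section Fermions

variable {R : Type*} [CommRing R]

/-- The basis vector of `S`. -/
def basisVector (R : Type*) [CommRing R] (S : Maya) : FinFock R := Finsupp.single S 1

open Classical in
/-- Exterior multiplication by `v_j` on finite vectors. -/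
def cre (j : ℤ) : Module.End R (FinFock R) :=
  Finsupp.linearCombination R fun S =>
    if j ∈ S.1 then 0 else S.sign j • basisVector R (S.insert j)

open Classical in
/-- Contraction with the coordinate form of `v_j` on finite vectors. -/
def contr (j : ℤ) : Module.End R (FinFock R) :=
  Finsupp.linearCombination R fun S =>
    if j ∈ S.1 then (S.erase j).sign j • basisVector R (S.erase j) else 0

theorem cre_basisVector {j : ℤ} {S : Maya} (h : j ∉ S.1) :
    cre j (basisVector R S) = S.sign j • basisVector R (S.insert j) := by
  simp [cre, basisVector, h]

theorem cre_basisVector_of_mem {j : ℤ} {S : Maya} (h : j ∈ S.1) :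
    cre j (basisVector R S) = 0 := by
  simp [cre, basisVector, h]

theorem contr_basisVector_insert {j : ℤ} {S : Maya} (h : j ∉ S.1) :
    contr j (basisVector R (S.insert j)) = S.sign j • basisVector R S := by
  simp [contr, basisVector, Maya.erase_insert h]

theorem contr_basisVector {j : ℤ} {S : Maya} (h : j ∈ S.1) :
    contr j (basisVector R S) = (S.erase j).sign j • basisVector R (S.erase j) := by
  simp [contr, basisVector, h]

theorem contr_basisVector_of_notMem {j : ℤ} {S : Maya} (h : j ∉ S.1) :
    contr j (basisVector R S) = 0 := by
  simp [contr, basisVector, h]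

theorem FinFock.linearMap_ext {M : Type*} [AddCommMonoid M] [Module R M]
    {A B : FinFock R →ₗ[R] M} (h : ∀ S, A (basisVector R S) = B (basisVector R S)) : A = B :=
  Finsupp.lhom_ext' fun S => LinearMap.ext_ring (h S)

theorem FinFock.induction {p : FinFock R → Prop} (w : FinFock R) (zero : p 0)
    (add : ∀ v w, p v → p w → p (v + w)) (basis : ∀ (c : R) S, p (c • basisVector R S)) : p w :=
  Finsupp.induction_linear w zero add fun S c => by
    have := basis c S
    rwa [basisVector, Finsupp.smul_single, smul_eq_mul, mul_one] at this

theorem cre_mul_cre (i j : ℤ) : (cre i * cre j : Module.End R (FinFock R)) = -(cre j * cre i) := by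
  refine FinFock.linearMap_ext fun S => ?_
  simp only [Module.End.mul_apply, LinearMap.neg_apply]
  by_cases hi : i ∈ S.1
  · rw [cre_basisVector_of_mem hi, map_zero, neg_zero]
    by_cases hj : j ∈ S.1
    · rw [cre_basisVector_of_mem hj, map_zero]
    · rw [cre_basisVector hj, map_zsmul, cre_basisVector_of_mem (Or.inr hi), smul_zero]
  by_cases hj : j ∈ S.1
  · rw [cre_basisVector_of_mem hj, map_zero, cre_basisVector hi, map_zsmul,
      cre_basisVector_of_mem (Or.inr hj), smul_zero, neg_zero]
  rcases eq_or_ne i j with rfl | hij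
  · rw [cre_basisVector hi, map_zsmul, cre_basisVector_of_mem (Or.inl rfl), smul_zero, neg_zero]
  · rw [cre_basisVector hi, cre_basisVector hj, map_zsmul, map_zsmul,
      cre_basisVector (show i ∉ (S.insert j).1 by simp [hi, hij]),
      cre_basisVector (show j ∉ (S.insert i).1 by simp [hj, hij.symm]), smul_smul, smul_smul,
      Maya.insert_comm j i, Maya.sign_mul_sign_insert hij hi hj, neg_smul]

theorem contr_mul_contr (i j : ℤ) :
    (contr i * contr j : Module.End R (FinFock R)) = -(contr j * contr i) := by
  refine FinFock.linearMap_ext fun S => ?_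
  simp only [Module.End.mul_apply, LinearMap.neg_apply]
  by_cases hi : i ∈ S.1
  · obtain ⟨S, hiS, rfl⟩ : ∃ T : Maya, i ∉ T.1 ∧ S = T.insert i :=
      ⟨S.erase i, by simp, (Maya.insert_erase hi).symm⟩
    rcases eq_or_ne i j with rfl | hij
    · rw [contr_basisVector_insert hiS, map_zsmul, contr_basisVector_of_notMem hiS, smul_zero,
        neg_zero]
    by_cases hj : j ∈ S.1
    · obtain ⟨S, hjS, rfl⟩ : ∃ T : Maya, j ∉ T.1 ∧ S = T.insert j :=
        ⟨S.erase j, by simp, (Maya.insert_erase hj).symm⟩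
      have hiS' : i ∉ S.1 := fun h => hiS (Or.inr h)
      have hjS' : j ∉ (S.insert i).1 := by simp [hjS, hij.symm]
      rw [contr_basisVector_insert hiS, Maya.insert_comm, contr_basisVector_insert hjS', map_zsmul,
        map_zsmul, contr_basisVector_insert hjS, contr_basisVector_insert hiS', smul_smul,
        smul_smul, ← neg_smul]
      congr 1
      linear_combination Maya.sign_mul_sign_insert hij hiS' hjS
    · rw [contr_basisVector_of_notMem (show j ∉ (S.insert i).1 by simp [hj, hij.symm]), map_zero,
        contr_basisVector_insert hiS, map_zsmul, contr_basisVector_of_notMem hj, smul_zero,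
        neg_zero]
  · rw [contr_basisVector_of_notMem hi, map_zero, neg_zero]
    by_cases hj : j ∈ S.1
    · rw [contr_basisVector hj, map_zsmul,
        contr_basisVector_of_notMem (show i ∉ (S.erase j).1 from fun h => hi h.1), smul_zero]
    · rw [contr_basisVector_of_notMem hj, map_zero]

theorem contr_mul_cre_self (i : ℤ) :
    (contr i * cre i : Module.End R (FinFock R)) = 1 - cre i * contr i := by
  refine FinFock.linearMap_ext fun S => ?_
  simp only [Module.End.mul_apply, LinearMap.sub_apply, Module.End.one_apply]
  by_cases hi : i ∈ S.1
  · obtain ⟨S, hiS, rfl⟩ : ∃ T : Maya, i ∉ T.1 ∧ S = T.insert i :=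
      ⟨S.erase i, by simp, (Maya.insert_erase hi).symm⟩
    rw [contr_basisVector_insert hiS, cre_basisVector_of_mem hi, map_zsmul, cre_basisVector hiS,
      smul_smul, Maya.sign_mul_self, one_smul, sub_self, map_zero]
  · rw [contr_basisVector_of_notMem hi, cre_basisVector hi, map_zsmul, contr_basisVector_insert hi,
      smul_smul, Maya.sign_mul_self, one_smul, map_zero, sub_zero]

theorem contr_mul_cre_of_ne {i j : ℤ} (hij : i ≠ j) :
    (contr i * cre j : Module.End R (FinFock R)) = -(cre j * contr i) := by
  refine FinFock.linearMap_ext fun S => ?_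
  simp only [Module.End.mul_apply, LinearMap.neg_apply]
  by_cases hi : i ∈ S.1
  · obtain ⟨S, hiS, rfl⟩ : ∃ T : Maya, i ∉ T.1 ∧ S = T.insert i :=
      ⟨S.erase i, by simp, (Maya.insert_erase hi).symm⟩
    by_cases hj : j ∈ S.1
    · rw [cre_basisVector_of_mem (show j ∈ (S.insert i).1 from Or.inr hj),
        contr_basisVector_insert hiS, map_zsmul, cre_basisVector_of_mem hj, map_zero, smul_zero,
        neg_zero]
    · rw [cre_basisVector (show j ∉ (S.insert i).1 by simp [hj, hij.symm]), Maya.insert_comm,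
        contr_basisVector_insert hiS, map_zsmul, map_zsmul,
        contr_basisVector_insert (show i ∉ (S.insert j).1 by simp [hiS, hij]), cre_basisVector hj,
        smul_smul, smul_smul, ← neg_smul]
      congr 1
      -- The exchange identity multiplied by the two signs of site `i`; signs square to 1.
      have h := Maya.sign_mul_sign_insert hij hiS hj
      have h2 := Maya.sign_mul_self i S
      have h3 := Maya.sign_mul_self i (S.insert j)
      linear_combination S.sign i * (S.insert j).sign i * h - S.sign i * S.sign j * h3 -
        (S.insert i).sign j * (S.insert j).sign i * h2
  · rw [contr_basisVector_of_notMem hi, map_zero, neg_zero]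
    by_cases hj : j ∈ S.1
    · rw [cre_basisVector_of_mem hj, map_zero]
    · rw [cre_basisVector hj, map_zsmul,
        contr_basisVector_of_notMem (show i ∉ (S.insert j).1 by simp [hi, hij]), smul_zero]

theorem cre_mul_self (i : ℤ) : (cre i * cre i : Module.End R (FinFock R)) = 0 := by
  refine FinFock.linearMap_ext fun S => ?_
  by_cases hi : i ∈ S.1
  · simp [cre_basisVector_of_mem hi]
  · simp [cre_basisVector hi, cre_basisVector_of_mem (show i ∈ (S.insert i).1 from Or.inl rfl)]

/-- All sufficiently deep sites are filled in each of the finitely many basis vectors involved. This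
makes sums such as ∑ c_m ψ_{n-m} finite on every finite vector. -/
theorem exists_cre_eq_zero (w : FinFock R) : ∃ b : ℤ, ∀ i < b, cre i w = 0 := by
  induction w using FinFock.induction with
  | zero => exact ⟨0, fun _ _ => map_zero _⟩
  | add v w hv hw =>
    obtain ⟨a, ha⟩ := hv
    obtain ⟨b, hb⟩ := hw
    refine ⟨min a b, fun i hi => ?_⟩
    rw [map_add, ha i (by omega), hb i (by omega), add_zero]
  | basis c S =>
    obtain ⟨b, hb⟩ := S.exists_ge_of_notMem
    refine ⟨b, fun i hi => ?_⟩
    rw [map_smul, cre_basisVector_of_mem (by_contra fun h => hi.not_ge (hb i h)), smul_zero]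

theorem exists_contr_eq_zero (w : FinFock R) : ∃ a : ℤ, ∀ i > a, contr i w = 0 := by
  induction w using FinFock.induction with
  | zero => exact ⟨0, fun _ _ => map_zero _⟩
  | add v w hv hw =>
    obtain ⟨a, ha⟩ := hv
    obtain ⟨b, hb⟩ := hw
    refine ⟨max a b, fun i hi => ?_⟩
    rw [map_add, ha i (by omega), hb i (by omega), add_zero]
  | basis c S =>
    obtain ⟨a, ha⟩ := S.exists_le_of_mem
    refine ⟨a, fun i hi => ?_⟩
    rw [map_smul, contr_basisVector_of_notMem fun h => not_lt.mpr (ha i h) hi, smul_zero]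

end Fermions

/-! ### Formal vectors as functionals on finite vectors; transposes -/

section Duality

variable {k : Type*} [Field k]

/-- The pairing of a formal vector with a finite vector. -/
abbrev pair (v : Fock k) : FinFock (MvPowerSeries ℕ k) →ₗ[MvPowerSeries ℕ k] MvPowerSeries ℕ k :=
  Finsupp.linearCombination _ v

theorem pair_basisVector (v : Fock k) (S : Maya) : pair v (basisVector _ S) = v S := by
  simp [pair, basisVector]

/-- The transpose of an operator on finite vectors. -/
def transpose (A : Module.End (MvPowerSeries ℕ k) (FinFock (MvPowerSeries ℕ k))) (v : Fock k) :
    Fock k :=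
  fun S => pair v (A (basisVector _ S))

theorem pair_transpose (A : Module.End (MvPowerSeries ℕ k) (FinFock (MvPowerSeries ℕ k)))
    (v : Fock k) : pair (transpose A v) = pair v ∘ₗ A :=
  FinFock.linearMap_ext fun S => by rw [pair_basisVector]; rfl

theorem transpose_transpose (A B : Module.End (MvPowerSeries ℕ k) (FinFock (MvPowerSeries ℕ k)))
    (v : Fock k) : transpose A (transpose B v) = transpose (B * A) v := by
  funext S
  rw [transpose, pair_transpose]
  rfl

theorem psi_eq_transpose (j : ℤ) (v : Fock k) : psi j v = transpose (contr j) v := by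
  funext S
  by_cases h : j ∈ S.1
  · simp [psi, h, transpose, contr_basisVector h, pair_basisVector]
  · simp [psi, h, transpose, contr_basisVector_of_notMem h]

theorem psiStar_eq_transpose (j : ℤ) (v : Fock k) : psiStar j v = transpose (cre j) v := by
  funext S
  by_cases h : j ∈ S.1
  · simp [psiStar, h, transpose, cre_basisVector_of_mem h]
  · simp [psiStar, h, transpose, cre_basisVector h, pair_basisVector]

theorem transpose_add (A : Module.End (MvPowerSeries ℕ k) (FinFock (MvPowerSeries ℕ k)))
    (v w : Fock k) : transpose A (v + w) = transpose A v + transpose A w := by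
  have : pair (v + w) = pair v + pair w :=
    FinFock.linearMap_ext fun S => by simp [pair, basisVector]
  funext S
  simp only [transpose, this, LinearMap.add_apply, Pi.add_apply]

theorem transpose_smul (A : Module.End (MvPowerSeries ℕ k) (FinFock (MvPowerSeries ℕ k)))
    (c : MvPowerSeries ℕ k) (v : Fock k) : transpose A (c • v) = c • transpose A v := by
  have : pair (c • v) = c • pair v :=
    FinFock.linearMap_ext fun S => by simp [pair, basisVector]
  funext S
  simp only [transpose, this, LinearMap.smul_apply, Pi.smul_apply]

/-- This links the two descriptions of a fermion: a transpose on all formal vectors, as Θ requires,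
and an operator preserving finite vectors, as H requires. -/
theorem transpose_coe_eq {A B : Module.End (MvPowerSeries ℕ k) (FinFock (MvPowerSeries ℕ k))}
    (h : ∀ S T, A (basisVector _ T) S = B (basisVector _ S) T) (w : FinFock (MvPowerSeries ℕ k)) :
    transpose A ⇑w = ⇑(B w) := by
  induction w using FinFock.induction with
  | zero =>
    have := transpose_smul A 0 0
    simpa using this
  | add v w hv hw => rw [Finsupp.coe_add, transpose_add, hv, hw, map_add, Finsupp.coe_add]
  | basis c S =>
    rw [Finsupp.coe_smul, transpose_smul, map_smul, Finsupp.coe_smul]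
    congr 1
    funext T
    rw [← h, transpose]
    rw [pair, Finsupp.linearCombination_apply, Finsupp.sum, Finset.sum_eq_single S]
    · simp [basisVector]
    · intro T' _ hT'
      simp [basisVector, hT'.symm]
    · intro hS
      rw [Finsupp.notMem_support_iff.mp hS, zero_smul]

theorem contr_basisVector_apply {R : Type*} [CommRing R] (j : ℤ) (S T : Maya) :
    contr j (basisVector R T) S = cre j (basisVector R S) T := by
  classical
  by_cases hj : j ∈ T.1
  · by_cases hS : j ∈ S.1
    · have h1 : T.erase j ≠ S := by rintro rfl; exact hS.2 rfl
      rw [contr_basisVector hj, cre_basisVector_of_mem hS]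
      simp [basisVector, h1]
    · rw [contr_basisVector hj, cre_basisVector hS]
      by_cases h : S.insert j = T
      · subst h
        simp [basisVector, Maya.erase_insert hS]
      · have h1 : T.erase j ≠ S := by rintro rfl; exact h (Maya.insert_erase hj)
        simp [basisVector, h1, h]
  · rw [contr_basisVector_of_notMem hj]
    by_cases hS : j ∈ S.1
    · rw [cre_basisVector_of_mem hS]; simp
    · have h : S.insert j ≠ T := by rintro rfl; exact hj (Or.inl rfl)
      rw [cre_basisVector hS]
      simp [basisVector, h]

theorem psi_coe (j : ℤ) (w : FinFock (MvPowerSeries ℕ k)) : psi j ⇑w = ⇑(cre j w) := by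
  rw [psi_eq_transpose]
  exact transpose_coe_eq (fun S T => contr_basisVector_apply j S T) w

theorem psiStar_coe (j : ℤ) (w : FinFock (MvPowerSeries ℕ k)) : psiStar j ⇑w = ⇑(contr j w) := by
  rw [psiStar_eq_transpose]
  exact transpose_coe_eq (fun S T => (contr_basisVector_apply j T S).symm) w

end Duality

/-- A sum over a square, grouped by antidiagonals. -/
theorem sum_range_antidiagonal_eq {M : Type*} [AddCommMonoid M] {K : ℕ} (g : ℕ → ℕ → M)
    (hg : ∀ i j, K ≤ i ∨ K ≤ j → g i j = 0) :
    ∑ n ∈ Finset.range (2 * K), ∑ p ∈ Finset.HasAntidiagonal.antidiagonal n, g p.1 p.2 =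
      ∑ i ∈ Finset.range K, ∑ j ∈ Finset.range K, g i j := by
  rw [← Finset.sum_product' (f := g), ← Finset.sum_fiberwise_of_maps_to
    (s := Finset.range K ×ˢ Finset.range K) (t := Finset.range (2 * K)) (g := fun p => p.1 + p.2)
    (fun p hp => by
      simp only [Finset.mem_product, Finset.mem_range] at hp ⊢
      omega)]
  refine Finset.sum_congr rfl fun n _ => (Finset.sum_subset (fun p hp => ?_) fun p hp h => ?_).symm
  · exact Finset.HasAntidiagonal.mem_antidiagonal.mpr (Finset.mem_filter.mp hp).2
  · refine hg _ _ (by_contra fun h' => h ?_)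
    rw [Finset.HasAntidiagonal.mem_antidiagonal] at hp
    simp only [Finset.mem_filter, Finset.mem_product, Finset.mem_range]
    omega

theorem sum_eq_sum_range_of_le {M : Type*} [AddCommMonoid M] {f : ℕ → M} {K : ℕ}
    (hf : ∀ n, K ≤ n → f n = 0) {L : ℕ} (hL : K ≤ L) :
    ∑ n ∈ Finset.range K, f n = ∑ n ∈ Finset.range L, f n :=
  Finset.sum_subset (Finset.range_mono hL) fun n _ hn => hf n (by simpa using hn)

theorem finsum_eq_sum_range {M : Type*} [AddCommMonoid M] {f : ℕ → M} {K : ℕ}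
    (hf : ∀ n, K ≤ n → f n = 0) : ∑ᶠ n, f n = ∑ n ∈ Finset.range K, f n :=
  finsum_eq_sum_of_support_subset _ fun n hn => by
    simp only [Finset.coe_range, Set.mem_Iio]
    exact not_le.mp fun h => hn (hf n h)

theorem inv_factorial_smul_choose_nsmul {M : Type*} [AddCommGroup M] [Module ℚ M] {n : ℕ}
    {p : ℕ × ℕ} (hp : p ∈ Finset.HasAntidiagonal.antidiagonal n) (x : M) :
    ((n.factorial : ℚ)⁻¹) • n.choose p.1 • x =
      ((p.1.factorial : ℚ)⁻¹) • ((p.2.factorial : ℚ)⁻¹) • x := by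
  rw [Finset.HasAntidiagonal.mem_antidiagonal] at hp
  subst hp
  rw [← Nat.cast_smul_eq_nsmul ℚ, smul_smul, smul_smul, Nat.cast_add_choose]
  congr 1
  have := Nat.factorial_ne_zero (p.1 + p.2)
  field_simp

/-! ### Exponentials of locally nilpotent operators -/

section LocallyNilpotent

variable {R M : Type*} [CommRing R] [AddCommGroup M] [Module R M]

/-- Every vector is killed by some power of the operator. -/
def LocallyNilpotent (A : Module.End R M) : Prop := ∀ w, ∃ N : ℕ, (A ^ N) w = 0

theorem pow_apply_eq_zero_of_le {A : Module.End R M} {w : M} {N n : ℕ} (h : (A ^ N) w = 0)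
    (hn : N ≤ n) : (A ^ n) w = 0 := by
  rw [← Nat.sub_add_cancel hn, pow_add, Module.End.mul_apply, h, map_zero]

theorem LocallyNilpotent.smul {A : Module.End R M} (hA : LocallyNilpotent A) (c : R) :
    LocallyNilpotent (c • A) := fun w => by
  obtain ⟨N, hN⟩ := hA w
  exact ⟨N, by rw [smul_pow, LinearMap.smul_apply, hN, smul_zero]⟩

variable [Module ℚ M]

/-- The exponential of a locally nilpotent operator. -/
def locExp (A : Module.End R M) (w : M) : M := ∑ᶠ j : ℕ, ((j.factorial : ℚ)⁻¹) • (A ^ j) w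

theorem locExp_eq_sum {A : Module.End R M} {w : M} {N : ℕ} (h : (A ^ N) w = 0) :
    locExp A w = ∑ j ∈ Finset.range N, ((j.factorial : ℚ)⁻¹) • (A ^ j) w :=
  finsum_eq_sum_range fun n hn => by rw [pow_apply_eq_zero_of_le h hn, smul_zero]

theorem locExp_of_apply_eq_zero {A : Module.End R M} {w : M} (h : A w = 0) : locExp A w = w := by
  rw [locExp_eq_sum (N := 1) (by simpa using h)]
  simp

theorem locExp_add {A : Module.End R M} (hA : LocallyNilpotent A) (v w : M) :
    locExp A (v + w) = locExp A v + locExp A w := by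
  obtain ⟨N, hN⟩ := hA v
  obtain ⟨N', hN'⟩ := hA w
  have h1 := pow_apply_eq_zero_of_le hN (le_max_left N N')
  have h2 := pow_apply_eq_zero_of_le hN' (le_max_right N N')
  rw [locExp_eq_sum h1, locExp_eq_sum h2, locExp_eq_sum (N := max N N')
    (by rw [map_add, h1, h2, add_zero]), ← Finset.sum_add_distrib]
  simp only [map_add, smul_add]

theorem locExp_smul {A : Module.End R M} (hA : LocallyNilpotent A) (c : R) (w : M) :
    locExp A (c • w) = c • locExp A w := by
  obtain ⟨N, hN⟩ := hA w
  rw [locExp_eq_sum hN, locExp_eq_sum (N := N) (by rw [map_smul, hN, smul_zero]), Finset.smul_sum]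
  exact Finset.sum_congr rfl fun j _ => by rw [map_smul, smul_comm]

/-- The exponential of a locally nilpotent operator as a linear map. -/
def locExpEnd (A : Module.End R M) (hA : LocallyNilpotent A) : Module.End R M where
  toFun := locExp A
  map_add' := locExp_add hA
  map_smul' := locExp_smul hA

@[simp] theorem locExpEnd_apply (A : Module.End R M) (hA : LocallyNilpotent A) (w : M) :
    locExpEnd A hA w = locExp A w := rfl

/-- Multiples of `A` commute, so the binomial theorem applies. Terms with either index at least `N`
vanish, so the Cauchy product may be summed over a square or over antidiagonals. -/
theorem locExp_add_smul {A : Module.End R M} (hA : LocallyNilpotent A) (a b : R) (w : M) :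
    locExp (a • A) (locExp (b • A) w) = locExp ((a + b) • A) w := by
  obtain ⟨N, hN⟩ := hA w
  have hz : ∀ i j, N ≤ i ∨ N ≤ j → (A ^ i) ((A ^ j) w) = 0 := by
    intro i j h
    rw [← Module.End.mul_apply, ← pow_add]
    exact pow_apply_eq_zero_of_le hN (by omega)
  have hb : ((b • A) ^ N) w = 0 := by rw [smul_pow, LinearMap.smul_apply, hN, smul_zero]
  have hab : (((a + b) • A) ^ (2 * N)) w = 0 := by
    rw [smul_pow, LinearMap.smul_apply, pow_apply_eq_zero_of_le hN (by omega), smul_zero]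
  rw [locExp_eq_sum hab, locExp_eq_sum hb, locExp_eq_sum (N := N) (by
    simp only [map_sum, smul_pow, LinearMap.smul_apply]
    refine Finset.sum_eq_zero fun j _ => ?_
    rw [map_rat_smul, map_smul, hz _ _ (Or.inl le_rfl), smul_zero, smul_zero, smul_zero])]
  have := sum_range_antidiagonal_eq (K := N) (fun i j => ((i.factorial : ℚ)⁻¹) •
    ((j.factorial : ℚ)⁻¹) • ((a • A) ^ i) (((b • A) ^ j) w)) (fun i j h => by
      rw [smul_pow, smul_pow, LinearMap.smul_apply, LinearMap.smul_apply, map_smul, hz i j h]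
      simp only [smul_zero])
  simp only [map_sum, Finset.smul_sum]
  simp only [map_rat_smul]
  rw [← this]
  refine Finset.sum_congr rfl fun n _ => ?_
  rw [add_smul, Commute.add_pow' (show Commute (a • A) (b • A) from
    ((Commute.refl A).smul_left a).smul_right b), LinearMap.sum_apply, Finset.smul_sum]
  refine Finset.sum_congr rfl fun p hp => ?_
  rw [LinearMap.smul_apply, inv_factorial_smul_choose_nsmul hp, Module.End.mul_apply]

end LocallyNilpotent

/-! ### Power series acting on families of operators; conjugation by an exponential -/

section SeriesAction

open PowerSeries

variable {R M : Type*} [CommRing R] [AddCommGroup M] [Module R M]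

/-- Every vector is killed by almost all the operators. -/
def LocallyFinite (φ : ℕ → Module.End R M) : Prop := ∀ w, ∃ K : ℕ, ∀ m, K ≤ m → φ m w = 0

theorem LocallyFinite.finsum_eq {φ : ℕ → Module.End R M} {w : M} {K : ℕ}
    (hK : ∀ m, K ≤ m → φ m w = 0) (f : R⟦X⟧) :
    ∑ᶠ m, coeff m f • φ m w = ∑ m ∈ Finset.range K, coeff m f • φ m w :=
  finsum_eq_sum_range fun n hn => by rw [hK n hn, smul_zero]

/-- The operators `∑_m f_m φ_m`, for a power series `f = ∑_m f_m z^m`. -/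
def seriesAction (φ : ℕ → Module.End R M) (hφ : LocallyFinite φ) :
    R⟦X⟧ →ₗ[R] M →ₗ[R] M :=
  LinearMap.mk₂ R (fun f w => ∑ᶠ m, coeff m f • φ m w)
    (fun f g w => by
      obtain ⟨K, hK⟩ := hφ w
      simp only [LocallyFinite.finsum_eq hK]
      simp only [map_add, add_smul, Finset.sum_add_distrib])
    (fun c f w => by
      obtain ⟨K, hK⟩ := hφ w
      simp only [LocallyFinite.finsum_eq hK]
      simp only [map_smul, smul_assoc, Finset.smul_sum])
    (fun f v w => by
      obtain ⟨K, hK⟩ := hφ v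
      obtain ⟨L, hL⟩ := hφ w
      have h1 : ∀ m, max K L ≤ m → φ m v = 0 := fun m hm => hK m (le_of_max_le_left hm)
      have h2 : ∀ m, max K L ≤ m → φ m w = 0 := fun m hm => hL m (le_of_max_le_right hm)
      have h3 : ∀ m, max K L ≤ m → φ m (v + w) = 0 := fun m hm => by
        rw [map_add, h1 m hm, h2 m hm, add_zero]
      simp only [LocallyFinite.finsum_eq h1, LocallyFinite.finsum_eq h2, LocallyFinite.finsum_eq h3]
      simp only [map_add, smul_add, Finset.sum_add_distrib])
    (fun c f w => by
      obtain ⟨K, hK⟩ := hφ w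
      have h : ∀ m, K ≤ m → φ m (c • w) = 0 := fun m hm => by rw [map_smul, hK m hm, smul_zero]
      simp only [LocallyFinite.finsum_eq hK, LocallyFinite.finsum_eq h]
      simp only [map_smul, Finset.smul_sum]
      exact Finset.sum_congr rfl fun m _ => smul_comm _ _ _)

variable {φ : ℕ → Module.End R M} (hφ : LocallyFinite φ)

theorem seriesAction_apply (f : R⟦X⟧) (w : M) :
    seriesAction φ hφ f w = ∑ᶠ m, coeff m f • φ m w := rfl

theorem seriesAction_eq_sum {w : M} {K : ℕ} (hK : ∀ m, K ≤ m → φ m w = 0) (f : R⟦X⟧) :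
    seriesAction φ hφ f w = ∑ m ∈ Finset.range K, coeff m f • φ m w :=
  LocallyFinite.finsum_eq hK f

theorem seriesAction_congr {w : M} {K : ℕ} (hK : ∀ m, K ≤ m → φ m w = 0) {f g : R⟦X⟧}
    (h : ∀ m < K, coeff m f = coeff m g) : seriesAction φ hφ f w = seriesAction φ hφ g w := by
  rw [seriesAction_eq_sum hφ hK, seriesAction_eq_sum hφ hK]
  exact Finset.sum_congr rfl fun m hm => by rw [h m (Finset.mem_range.mp hm)]

/-- If `[L, φ_n] = ∑_l c_l φ_{n+l}`, then `[L, ∑_m f_m φ_m] = ∑_m (c f)_m φ_m`. -/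
theorem apply_seriesAction {L : Module.End R M} {c : R⟦X⟧}
    (hL : ∀ n w, L (φ n w) = φ n (L w) + ∑ᶠ l, coeff l c • φ (n + l) w) (f : R⟦X⟧) (w : M) :
    L (seriesAction φ hφ f w) = seriesAction φ hφ f (L w) + seriesAction φ hφ (c * f) w := by
  obtain ⟨K, hK⟩ := hφ w
  obtain ⟨K', hK'⟩ := hφ (L w)
  set Q := max K K'
  have h1 : ∀ m, Q ≤ m → φ m w = 0 := fun m hm => hK m (le_of_max_le_left hm)
  have h2 : ∀ m, Q ≤ m → φ m (L w) = 0 := fun m hm => hK' m (le_of_max_le_right hm)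
  rw [seriesAction_eq_sum hφ h1, seriesAction_eq_sum hφ h2, map_sum,
    seriesAction_eq_sum hφ (K := 2 * Q) (fun m hm => h1 m (by omega))]
  have h3 : ∀ n ∈ Finset.range (2 * Q), coeff n (c * f) • φ n w =
      ∑ p ∈ Finset.HasAntidiagonal.antidiagonal n, coeff p.2 f • coeff p.1 c • φ (p.2 + p.1) w := by
    intro n _
    rw [coeff_mul, Finset.sum_smul]
    refine Finset.sum_congr rfl fun p hp => ?_
    rw [smul_smul, mul_comm, add_comm, Finset.HasAntidiagonal.mem_antidiagonal.mp hp]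
  rw [Finset.sum_congr rfl h3, sum_range_antidiagonal_eq (K := Q)
    (fun l m => coeff m f • coeff l c • φ (m + l) w)
    (fun l m h => by rw [h1 _ (by omega), smul_zero, smul_zero]), Finset.sum_comm,
    ← Finset.sum_add_distrib]
  refine Finset.sum_congr rfl fun m _ => ?_
  rw [map_smul, hL, smul_add, finsum_eq_sum_range (K := Q)
    (fun l hl => by rw [h1 _ (by omega), smul_zero]), Finset.smul_sum]

open TensorProduct in
-- The Leibniz rule: on the tensor product `L` corresponds to μ ⊗ 1 + 1 ⊗ L, a sum of commuting
-- operators, to which the binomial theorem applies.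
theorem pow_apply_bilinear {P : Type*} [AddCommGroup P] [Module R P] (B : P →ₗ[R] M →ₗ[R] M)
    {L : Module.End R M} {μ : Module.End R P}
    (h : ∀ f w, L (B f w) = B f (L w) + B (μ f) w) (n : ℕ) (f : P) (w : M) :
    (L ^ n) (B f w) = ∑ p ∈ Finset.HasAntidiagonal.antidiagonal n,
      n.choose p.1 • B ((μ ^ p.1) f) ((L ^ p.2) w) := by
  have hc : L ∘ₗ TensorProduct.lift B =
      TensorProduct.lift B ∘ₗ (μ.rTensor M + L.lTensor P) := by
    ext f w
    simp [h, add_comm]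
  have hn : (L ^ n) ∘ₗ TensorProduct.lift B =
      TensorProduct.lift B ∘ₗ ((μ.rTensor M + L.lTensor P) ^ n) := by
    induction n with
    | zero => rfl
    | succ n ih =>
      rw [pow_succ, Module.End.mul_eq_comp, LinearMap.comp_assoc, hc, ← LinearMap.comp_assoc, ih,
        LinearMap.comp_assoc, ← Module.End.mul_eq_comp, ← pow_succ]
  have hcomm : Commute (μ.rTensor M) (L.lTensor P) := by
    ext f w
    simp
  have := LinearMap.congr_fun hn (f ⊗ₜ w)
  rw [LinearMap.comp_apply, TensorProduct.lift.tmul] at this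
  rw [this, LinearMap.comp_apply, hcomm.add_pow', LinearMap.sum_apply, map_sum]
  refine Finset.sum_congr rfl fun p _ => ?_
  rw [LinearMap.smul_apply, map_nsmul, Module.End.mul_apply, LinearMap.lTensor_pow,
    LinearMap.rTensor_pow, LinearMap.lTensor_tmul, LinearMap.rTensor_tmul, TensorProduct.lift.tmul]

/-- `exp(c)` for a power series `c` without constant term. -/
def expSeries [Algebra ℚ R] (c : R⟦X⟧) : R⟦X⟧ := (exp R).subst c

theorem coeff_pow_eq_zero {c : R⟦X⟧} (hc : constantCoeff c = 0) {n m : ℕ} (h : n < m) :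
    coeff n (c ^ m) = 0 :=
  X_pow_dvd_iff.mp (pow_dvd_pow_of_dvd (X_dvd_iff.mpr hc) m) n h

theorem coeff_expSeries [Algebra ℚ R] {c : R⟦X⟧} (hc : constantCoeff c = 0) {n K : ℕ} (h : n < K) :
    coeff n (expSeries c) = ∑ a ∈ Finset.range K, ((a.factorial : ℚ)⁻¹) • coeff n (c ^ a) := by
  rw [expSeries, coeff_subst' (HasSubst.of_constantCoeff_zero' hc), finsum_eq_sum_range (K := K)]
  · refine Finset.sum_congr rfl fun a _ => ?_
    rw [coeff_exp, one_div, algebraMap_smul]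
  · intro a ha
    rw [coeff_pow_eq_zero hc (h.trans_le ha), smul_zero]

/-- If `[L, φ_n] = ∑_l c_l φ_{n+l}`, then `e^L ∘ (∑_m f_m φ_m) = (∑_m (e^c f)_m φ_m) ∘ e^L`. -/
theorem locExp_seriesAction [Algebra ℚ R] [Module ℚ M] {L : Module.End R M}
    (hN : LocallyNilpotent L) {c : R⟦X⟧} (hc : constantCoeff c = 0)
    (hL : ∀ n w, L (φ n w) = φ n (L w) + ∑ᶠ l, coeff l c • φ (n + l) w) (f : R⟦X⟧) (w : M) :
    locExp L (seriesAction φ hφ f w) = seriesAction φ hφ (expSeries c * f) (locExp L w) := by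
  obtain ⟨N, hNw⟩ := hN w
  choose κ hκ using fun j => hφ ((L ^ j) w)
  -- `Q` bounds the nilpotency index on `w` and, uniformly in `j`, the indices `m` with φ_m (L^j w)
  -- ≠ 0.
  set Q := max N ((Finset.range N).sup κ) with hQ
  have hLw : ∀ j, Q ≤ j → (L ^ j) w = 0 := fun j hj =>
    pow_apply_eq_zero_of_le hNw (le_of_max_le_left hj)
  have hφw : ∀ j m, Q ≤ m → φ m ((L ^ j) w) = 0 := by
    intro j m hm
    rcases lt_or_ge j N with hj | hj
    · exact hκ j m ((Finset.le_sup (f := κ) (Finset.mem_range.mpr hj)).trans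
        (le_of_max_le_right hm))
    · rw [pow_apply_eq_zero_of_le hNw hj, map_zero]
  have hz : ∀ i j, Q ≤ i ∨ Q ≤ j → seriesAction φ hφ (c ^ i * f) ((L ^ j) w) = 0 := by
    rintro i j (h | h)
    · rw [← LinearMap.zero_apply (σ₁₂ := RingHom.id R) (M := M) (M₂ := M) ((L ^ j) w),
        ← map_zero (seriesAction φ hφ)]
      refine seriesAction_congr hφ (hφw j) fun m hm => ?_
      rw [map_zero]
      refine X_pow_dvd_iff.mp (Dvd.dvd.mul_right ?_ f) m (hm.trans_le h)
      exact pow_dvd_pow_of_dvd (X_dvd_iff.mpr hc) i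
    · rw [hLw j h, map_zero]
  have hpow : ∀ n, (L ^ n) (seriesAction φ hφ f w) = ∑ p ∈ Finset.HasAntidiagonal.antidiagonal n,
      n.choose p.1 • seriesAction φ hφ (c ^ p.1 * f) ((L ^ p.2) w) := by
    intro n
    rw [pow_apply_bilinear (seriesAction φ hφ) (μ := LinearMap.mulLeft R c)
      (fun f w => apply_seriesAction hφ hL f w)]
    simp only [LinearMap.pow_mulLeft, LinearMap.mulLeft_apply]
  rw [locExp_eq_sum (N := 2 * Q), locExp_eq_sum (hLw Q le_rfl)]
  · have h1 : ∀ n ∈ Finset.range (2 * Q),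
        ((n.factorial : ℚ)⁻¹) • (L ^ n) (seriesAction φ hφ f w) =
        ∑ p ∈ Finset.HasAntidiagonal.antidiagonal n,
          ((p.1.factorial : ℚ)⁻¹) • ((p.2.factorial : ℚ)⁻¹) •
          seriesAction φ hφ (c ^ p.1 * f) ((L ^ p.2) w) := by
      intro n _
      rw [hpow, Finset.smul_sum]
      exact Finset.sum_congr rfl fun p hp => inv_factorial_smul_choose_nsmul hp _
    rw [Finset.sum_congr rfl h1, sum_range_antidiagonal_eq (K := Q) (fun i j =>
      ((i.factorial : ℚ)⁻¹) • ((j.factorial : ℚ)⁻¹) • seriesAction φ hφ (c ^ i * f) ((L ^ j) w))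
      (fun i j h => by rw [hz i j h, smul_zero, smul_zero]), Finset.sum_comm, map_sum]
    refine Finset.sum_congr rfl fun j _ => ?_
    -- Only coefficients below `Q` act, and `c` has no constant term, so the exponential series may
    -- be cut off at `Q`.
    have h2 : seriesAction φ hφ (expSeries c * f) ((L ^ j) w) =
        seriesAction φ hφ ((∑ i ∈ Finset.range Q, ((i.factorial : ℚ)⁻¹) • c ^ i) * f)
          ((L ^ j) w) := by
      refine seriesAction_congr hφ (hφw j) fun m hm => ?_
      rw [coeff_mul, coeff_mul]
      refine Finset.sum_congr rfl fun p hp => ?_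
      rw [Finset.HasAntidiagonal.mem_antidiagonal] at hp
      rw [coeff_expSeries hc (show p.1 < Q by omega), map_sum]
      simp only [map_rat_smul]
    rw [map_rat_smul, h2, Finset.sum_mul, map_sum, LinearMap.sum_apply, Finset.smul_sum]
    refine Finset.sum_congr rfl fun i _ => ?_
    rw [smul_mul_assoc, map_rat_smul, LinearMap.smul_apply, smul_comm]
  · rw [hpow]
    refine Finset.sum_eq_zero fun p hp => ?_
    rw [Finset.HasAntidiagonal.mem_antidiagonal] at hp
    rw [hz _ _ (by omega), smul_zero]

end SeriesAction

/-! ### Exponential power series and their differential equation -/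

section ExpSeries

open PowerSeries

variable {R : Type*} [CommRing R] [Algebra ℚ R]

theorem constantCoeff_expSeries {c : R⟦X⟧} (hc : constantCoeff c = 0) :
    constantCoeff (expSeries c) = 1 := by
  rw [← coeff_zero_eq_constantCoeff_apply, coeff_expSeries hc zero_lt_one]
  simp

theorem derivative_expSeries {c : R⟦X⟧} (hc : constantCoeff c = 0) :
    d⁄dX R (expSeries c) = expSeries c * d⁄dX R c := by
  rw [expSeries, derivative_subst (HasSubst.of_constantCoeff_zero' hc), derivative_exp]

theorem map_expSeries {S : Type*} [CommRing S] [Algebra ℚ S] (φ : R →+* S) {c : R⟦X⟧}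
    (hc : constantCoeff c = 0) : map φ (expSeries c) = expSeries (map φ c) := by
  ext n
  have hc' : constantCoeff (map φ c) = 0 := by
    rw [← coeff_zero_eq_constantCoeff_apply, coeff_map, coeff_zero_eq_constantCoeff_apply, hc,
      map_zero]
  rw [coeff_map, coeff_expSeries hc n.lt_succ_self, coeff_expSeries hc' n.lt_succ_self, map_sum]
  refine Finset.sum_congr rfl fun a _ => ?_
  rw [map_rat_smul, ← map_pow, coeff_map]

/-- If `g' + c' g = 0` and `g(0) = 1`, then `e^c g = 1`. -/
theorem expSeries_mul_eq_one {c g : R⟦X⟧} (hc : constantCoeff c = 0) (hg : constantCoeff g = 1)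
    (h : d⁄dX R g + d⁄dX R c * g = 0) : expSeries c * g = 1 := by
  have : IsAddTorsionFree R := IsAddTorsionFree.of_module_rat R
  refine derivative.ext ?_ ?_
  · rw [Derivation.leibniz, derivative_expSeries hc, derivative_one, smul_eq_mul, smul_eq_mul]
    linear_combination expSeries c * h
  · rw [map_mul, constantCoeff_expSeries hc, hg, mul_one, map_one]

/-- `e^c` is the solution of `g' = c' g` with `g(0) = 1`. -/
theorem expSeries_eq_of_derivative {c g : R⟦X⟧} (hc : constantCoeff c = 0)
    (hg : constantCoeff g = 1) (h : d⁄dX R g = d⁄dX R c * g) : expSeries c = g := by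
  have hc' : constantCoeff (-c) = 0 := by rw [map_neg, hc, neg_zero]
  have h1 : expSeries (-c) * g = 1 :=
    expSeries_mul_eq_one hc' hg (by rw [h, map_neg]; ring)
  have h2 : expSeries (-c) * expSeries c = 1 :=
    expSeries_mul_eq_one hc' (constantCoeff_expSeries hc)
      (by rw [derivative_expSeries hc, map_neg]; ring)
  -- Both e^c and `g` are inverse to e^{-c}.
  linear_combination (-expSeries c) * h1 + g * h2

end ExpSeries

/-! ### Energy-lowering operators and their commutators with fermions -/

section Lower

open PowerSeries

variable {R : Type*} [CommRing R]

/-- The operator moving a particle from the site `i` down to the site `i - (m + 1)`, for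
`p = (m, i)`. -/
def moveDown (p : ℕ × ℤ) : Module.End R (FinFock R) := cre (p.2 - (p.1 + 1)) * contr p.2

theorem moveDown_basisVector (p : ℕ × ℤ) (S : Maya) :
    moveDown p (basisVector R S) = 0 ∨ (p.2 ∈ S.1 ∧ p.2 - (p.1 + 1) ∉ S.1 ∧ ∃ (ε : ℤ) (T : Maya),
      T.energy = S.energy - (p.1 + 1) ∧ moveDown p (basisVector R S) = ε • basisVector R T) := by
  obtain ⟨m, i⟩ := p
  simp only [moveDown, Module.End.mul_apply]
  by_cases hi : i ∈ S.1
  · by_cases hj : i - (m + 1) ∈ S.1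
    · left
      rw [contr_basisVector hi, map_zsmul, cre_basisVector_of_mem, smul_zero]
      exact ⟨hj, fun h => by have : i - (m + 1) = i := h; omega⟩
    · have hj' : i - (m + 1) ∉ (S.erase i).1 := fun h => hj h.1
      refine Or.inr ⟨hi, hj, (S.erase i).sign i * (S.erase i).sign (i - (m + 1)),
        (S.erase i).insert (i - (m + 1)), ?_, ?_⟩
      rotate_left
      · rw [contr_basisVector hi, map_zsmul, cre_basisVector hj', smul_smul]
      · have := Maya.energy_insert (S := S.erase i) (j := i) fun h => h.2 rfl
        rw [Maya.insert_erase hi] at this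
        rw [Maya.energy_insert hj', this]
        ring
  · left
    rw [contr_basisVector_of_notMem hi, map_zero]

/-- For a basis vector the source is occupied, hence at most `a`, and the target is empty, hence at
least `b`; this bounds both the source and the distance. All currents can thus be summed at once,
without truncation. -/
theorem hasFiniteSupport_moveDown (w : FinFock R) :
    Function.HasFiniteSupport fun p => moveDown p w := by
  induction w using FinFock.induction with
  | zero => simp [Function.HasFiniteSupport, Function.support]
  | add v w hv hw => simpa using! hv.add hw
  | basis c S =>
    obtain ⟨a, ha⟩ := S.exists_le_of_mem
    obtain ⟨b, hb⟩ := S.exists_ge_of_notMem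
    refine ((Set.finite_Iic (a - b).toNat).prod (Set.finite_Icc b a)).subset fun p hp => ?_
    have hp' : moveDown p (basisVector R S) ≠ 0 := fun h => hp (by simp [h])
    obtain ⟨h1, h2, -⟩ := (moveDown_basisVector p S).resolve_left hp'
    have h3 := ha _ h1
    have h4 := hb _ h2
    simp only [Set.mem_prod, Set.mem_Iic, Set.mem_Icc]
    omega

theorem hasFiniteSupport_smul_moveDown (c : R⟦X⟧) (w : FinFock R) :
    Function.HasFiniteSupport fun p : ℕ × ℤ => coeff (p.1 + 1) c • moveDown p w :=
  (hasFiniteSupport_moveDown w).subset fun p hp h => hp (by simp only [h, smul_zero])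

/-- The operator `∑_{m ≥ 1} c_m a_m` on finite vectors, where `a_m` moves a particle down by `m`
sites. -/
def lower (c : R⟦X⟧) : Module.End R (FinFock R) where
  toFun w := ∑ᶠ p : ℕ × ℤ, coeff (p.1 + 1) c • moveDown p w
  map_add' v w := by
    simp only [map_add, smul_add]
    exact finsum_add_distrib (hasFiniteSupport_smul_moveDown c v)
      (hasFiniteSupport_smul_moveDown c w)
  map_smul' a w := by
    simp only [map_smul, RingHom.id_apply]
    rw [smul_finsum' a (hasFiniteSupport_smul_moveDown c w)]
    exact finsum_congr fun p => smul_comm _ _ _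

theorem lower_apply (c : R⟦X⟧) (w : FinFock R) :
    lower c w = ∑ᶠ p : ℕ × ℤ, coeff (p.1 + 1) c • moveDown p w := rfl

theorem lower_basisVector_mem (c : R⟦X⟧) (S : Maya) :
    lower c (basisVector R S) ∈ Finsupp.supported R R {T : Maya | T.energy < S.energy} := by
  rw [lower_apply]
  refine finsum_induction _ (Submodule.zero_mem _) (fun _ _ => Submodule.add_mem _) fun p => ?_
  refine Submodule.smul_mem _ _ ?_
  rcases moveDown_basisVector (R := R) p S with h | ⟨-, -, ε, T, hT, h⟩
  · rw [h]; exact Submodule.zero_mem _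
  · rw [h]
    refine zsmul_mem (Finsupp.single_mem_supported R 1 ?_) ε
    rw [Set.mem_ofPred_eq, hT]
    omega

theorem lower_mem_supported (c : R⟦X⟧) {n : ℤ} {w : FinFock R}
    (hw : w ∈ Finsupp.supported R R {T : Maya | T.energy < n + 1}) :
    lower c w ∈ Finsupp.supported R R {T : Maya | T.energy < n} := by
  rw [Finsupp.supported_eq_span_single] at hw
  induction hw using Submodule.span_induction with
  | mem x hx =>
    obtain ⟨S, hS, rfl⟩ := hx
    refine Finsupp.supported_mono (fun T hT => ?_) (lower_basisVector_mem c S)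
    simp only [Set.mem_ofPred_eq] at hS hT ⊢
    omega
  | zero => rw [map_zero]; exact Submodule.zero_mem _
  | add x y _ _ hx hy => rw [map_add]; exact Submodule.add_mem _ hx hy
  | smul a x _ hx => rw [map_smul]; exact Submodule.smul_mem _ _ hx

/-- Each application strictly lowers an energy that is a nonnegative integer, so `n` applications
kill vectors of energy below `n`. -/
theorem locallyNilpotent_lower (c : R⟦X⟧) : LocallyNilpotent (lower c) := by
  intro w
  have key : ∀ (n : ℕ) (w : FinFock R),
      w ∈ Finsupp.supported R R {T : Maya | T.energy < (n : ℤ)} → (lower c ^ n) w = 0 := by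
    intro n
    induction n with
    | zero =>
      intro w hw
      have : {T : Maya | T.energy < ((0 : ℕ) : ℤ)} = ∅ :=
        Set.eq_empty_of_forall_notMem fun T hT => by
          have := T.energy_nonneg
          simp only [Set.mem_ofPred_eq] at hT
          omega
      rw [this, Finsupp.supported_empty, Submodule.mem_bot] at hw
      rw [hw, map_zero]
    | succ n ih =>
      intro w hw
      rw [pow_succ, Module.End.mul_apply]
      exact ih _ (lower_mem_supported c (by exact_mod_cast hw))
  refine ⟨(w.support.sup fun T => T.energy.toNat + 1), key _ w ?_⟩
  rw [Finsupp.mem_supported]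
  intro T hT
  have h1 := Finset.le_sup (f := fun T : Maya => T.energy.toNat + 1) hT
  simp only [Set.mem_ofPred_eq]
  have := T.energy_nonneg
  omega

theorem locallyFinite_cre (n : ℤ) : LocallyFinite fun m : ℕ => (cre (n - m) : Module.End R _) := by
  intro w
  obtain ⟨b, hb⟩ := exists_cre_eq_zero w
  exact ⟨(n - b).toNat + 1, fun m hm => hb _ (by omega)⟩

theorem locallyFinite_contr (n : ℤ) :
    LocallyFinite fun m : ℕ => (contr (n + m) : Module.End R _) := by
  intro w
  obtain ⟨a, ha⟩ := exists_contr_eq_zero w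
  exact ⟨(a - n).toNat + 1, fun m hm => ha _ (by omega)⟩

theorem finsum_shift {M : Type*} [AddCommGroup M] [Module R M] {c : R⟦X⟧}
    (hc : constantCoeff c = 0) (f : ℕ → M) :
    ∑ᶠ m, coeff m c • f m = ∑ᶠ m, coeff (m + 1) c • f (m + 1) := by
  have : Function.support (fun m => coeff m c • f m) ⊆ Set.range Nat.succ := by
    intro m hm
    rcases m with _ | m
    · exact absurd (by simp [hc]) hm
    · exact ⟨m, rfl⟩
  rw [← finsum_mem_univ, ← finsum_mem_inter_support, Set.univ_inter, ← Set.inter_eq_right.mpr this,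
    finsum_mem_inter_support, finsum_mem_range Nat.succ_injective]

/-- In the commutator with ψ*_n the delta term survives only for moves whose target is `n`, that is,
from the source n + m + 1; the double sum over moves becomes a single one. -/
theorem finsum_pair_eq {M : Type*} [AddCommGroup M] (n : ℤ) {f : ℕ → M}
    (hf : ∃ K : ℕ, ∀ m, K ≤ m → f m = 0) :
    Function.HasFiniteSupport (fun p : ℕ × ℤ => if p.2 = n + (p.1 + 1) then f p.1 else 0) ∧
      ∑ᶠ p : ℕ × ℤ, (if p.2 = n + (p.1 + 1) then f p.1 else 0) = ∑ᶠ m, f m := by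
  obtain ⟨K, hK⟩ := hf
  have h : Function.HasFiniteSupport
      (fun p : ℕ × ℤ => if p.2 = n + (p.1 + 1) then f p.1 else 0) := by
    refine ((Set.finite_Iio K).image fun m : ℕ => (m, n + ((m : ℤ) + 1))).subset fun p hp => ?_
    rw [Function.mem_support] at hp
    split_ifs at hp with h
    · exact ⟨p.1, not_le.mp fun h' => hp (hK _ h'), Prod.ext rfl h.symm⟩
    · exact absurd rfl hp
  refine ⟨h, ?_⟩
  rw [finsum_curry _ h]
  refine finsum_congr fun m => ?_
  rw [finsum_eq_single _ (n + ((m : ℤ) + 1)) fun i hi => if_neg hi]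
  simp

theorem finsum_pair_eq' {M : Type*} [AddCommGroup M] (n : ℤ) {f : ℕ → M}
    (hf : ∃ K : ℕ, ∀ m, K ≤ m → f m = 0) :
    Function.HasFiniteSupport (fun p : ℕ × ℤ => if p.2 = n then f p.1 else 0) ∧
      ∑ᶠ p : ℕ × ℤ, (if p.2 = n then f p.1 else 0) = ∑ᶠ m, f m := by
  obtain ⟨K, hK⟩ := hf
  have h : Function.HasFiniteSupport (fun p : ℕ × ℤ => if p.2 = n then f p.1 else 0) := by
    refine ((Set.finite_Iio K).image fun m : ℕ => (m, n)).subset fun p hp => ?_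
    rw [Function.mem_support] at hp
    split_ifs at hp with h
    · exact ⟨p.1, not_le.mp fun h' => hp (hK _ h'), Prod.ext rfl h.symm⟩
    · exact absurd rfl hp
  refine ⟨h, ?_⟩
  rw [finsum_curry _ h]
  refine finsum_congr fun m => ?_
  rw [finsum_eq_single _ n fun i hi => if_neg hi]
  simp

/-- `[∑ c_m a_m, ψ_n] = ∑ c_m ψ_{n-m}`. -/
theorem lower_cre {c : R⟦X⟧} (hc : constantCoeff c = 0) (n : ℤ) (w : FinFock R) :
    lower c (cre n w) = cre n (lower c w) + ∑ᶠ l : ℕ, coeff l c • cre (n - l) w := by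
  have hfin : ∃ K : ℕ, ∀ m : ℕ, K ≤ m → coeff (m + 1) c • cre (n - (m + 1)) w = 0 := by
    obtain ⟨K, hK⟩ := locallyFinite_cre n w
    refine ⟨K, fun m hm => ?_⟩
    have := hK (m + 1) (by omega)
    push_cast at this
    rw [this, smul_zero]
  obtain ⟨h1, h2⟩ := finsum_pair_eq' n hfin
  rw [finsum_shift hc fun l : ℕ => cre (n - l) w, lower_apply, lower_apply]
  push_cast
  rw [← h2, map_finsum (cre n) (hasFiniteSupport_smul_moveDown c w), ← finsum_add_distrib _ h1]
  · refine finsum_congr fun p => ?_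
    rw [map_smul]
    have hcc : cre n (moveDown p w) = -cre (p.2 - (p.1 + 1)) (cre n (contr p.2 w)) := by
      rw [moveDown, Module.End.mul_apply, ← Module.End.mul_apply, cre_mul_cre]
      rfl
    rw [hcc]
    -- Only a move with source `n` meets ψ_n in a nonzero anticommutator and yields the extra term.
    by_cases hp : p.2 = n
    · rw [if_pos hp, ← smul_add, moveDown, hp, Module.End.mul_apply,
        ← Module.End.mul_apply (contr n),
        contr_mul_cre_self, LinearMap.sub_apply, map_sub]
      simp only [Module.End.mul_apply, Module.End.one_apply]
      congr 1
      abel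
    · rw [if_neg hp, add_zero, moveDown, Module.End.mul_apply, ← Module.End.mul_apply (contr p.2),
        contr_mul_cre_of_ne hp, LinearMap.neg_apply, map_neg]
      rfl
  · exact (hasFiniteSupport_smul_moveDown c w).subset fun p hp h => hp (by simp only [h, map_zero])

/-- `[ψ*_n, ∑ c_m a_m] = ∑ c_m ψ*_{n+m}`. -/
theorem contr_lower {c : R⟦X⟧} (hc : constantCoeff c = 0) (n : ℤ) (w : FinFock R) :
    contr n (lower c w) = lower c (contr n w) + ∑ᶠ l : ℕ, coeff l c • contr (n + l) w := by
  have hfin : ∃ K : ℕ, ∀ m : ℕ, K ≤ m → coeff (m + 1) c • contr (n + (m + 1)) w = 0 := by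
    obtain ⟨K, hK⟩ := locallyFinite_contr n w
    refine ⟨K, fun m hm => ?_⟩
    have := hK (m + 1) (by omega)
    push_cast at this
    rw [this, smul_zero]
  obtain ⟨h1, h2⟩ := finsum_pair_eq n hfin
  rw [finsum_shift hc fun l : ℕ => contr (n + l) w, lower_apply, lower_apply]
  push_cast
  rw [← h2, map_finsum (contr n) (hasFiniteSupport_smul_moveDown c w),
    ← finsum_add_distrib (hasFiniteSupport_smul_moveDown c (contr n w)) h1]
  refine finsum_congr fun p => ?_
  rw [map_smul]
  have hcc : moveDown p (contr n w) = -cre (p.2 - (p.1 + 1)) (contr n (contr p.2 w)) := by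
    rw [moveDown, Module.End.mul_apply, ← Module.End.mul_apply (contr p.2), contr_mul_contr,
      LinearMap.neg_apply, map_neg]
    rfl
  rw [hcc]
  by_cases hp : p.2 = n + (p.1 + 1)
  · rw [if_pos hp, ← smul_add, moveDown, Module.End.mul_apply, ← Module.End.mul_apply (contr n),
      show p.2 - (p.1 + 1) = n by omega, contr_mul_cre_self, LinearMap.sub_apply, hp]
    simp only [Module.End.mul_apply, Module.End.one_apply]
    congr 1
    abel
  · rw [if_neg hp, add_zero, moveDown, Module.End.mul_apply, ← Module.End.mul_apply (contr n),
      contr_mul_cre_of_ne (by omega), LinearMap.neg_apply]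
    rfl

end Lower

theorem hasFiniteSupport_prodMk {α β M : Type*} [AddCommMonoid M] {f : α × β → M}
    (hf : Function.HasFiniteSupport f) (a : α) : Function.HasFiniteSupport fun b => f (a, b) :=
  Set.Finite.preimage (f := fun b => (a, b)) (fun _ _ _ _ h => (Prod.mk.inj h).2) hf

theorem hasFiniteSupport_finsum {α β M : Type*} [AddCommMonoid M] {f : α × β → M}
    (hf : Function.HasFiniteSupport f) : Function.HasFiniteSupport fun a => ∑ᶠ b, f (a, b) :=
  (hf.image Prod.fst).subset fun a ha => by
    obtain ⟨b, hb⟩ : ∃ b, f (a, b) ≠ 0 := by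
      by_contra! h
      exact ha (finsum_eq_zero_of_forall_eq_zero h)
    exact ⟨(a, b), hb, rfl⟩

/-! ### The operators H and Θ, and the conjugation of fermions by Θ -/

section Operators

open PowerSeries hiding C X

variable {k : Type*} [Field k]

local notation "𝓡" => MvPowerSeries ℕ k

theorem formalSum_apply {ι : Type*} {f : ι → Fock k} {S : Maya}
    (h : Function.HasFiniteSupport fun i => f i S) : formalSum f S = ∑ᶠ i, f i S := by
  refine MvPowerSeries.ext fun d => ?_
  rw [map_finsum (MvPowerSeries.coeff d) h]
  rfl

theorem formalSum_transpose {ι : Type*} {A : ι → Module.End 𝓡 (FinFock 𝓡)}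
    {B : Module.End 𝓡 (FinFock 𝓡)}
    (hA : ∀ S, Function.HasFiniteSupport fun i => A i (basisVector 𝓡 S))
    (hB : ∀ S, ∑ᶠ i, A i (basisVector 𝓡 S) = B (basisVector 𝓡 S)) (v : Fock k) :
    formalSum (fun i => transpose (A i) v) = transpose B v := by
  funext S
  have h : Function.HasFiniteSupport fun i => transpose (A i) v S :=
    (hA S).subset fun i hi h => hi (by simp only [transpose, h, map_zero])
  rw [formalSum_apply h, transpose, ← hB, map_finsum (pair v) (hA S)]
  rfl

theorem formalSum_coe {ι : Type*} {g : ι → FinFock 𝓡} (hg : Function.HasFiniteSupport g) :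
    formalSum (fun i => ⇑(g i)) = ⇑(∑ᶠ i, g i) := by
  funext S
  have h : Function.HasFiniteSupport fun i => g i S :=
    hg.subset fun i hi h => hi (by simp only [h, Finsupp.coe_zero, Pi.zero_apply])
  rw [formalSum_apply h, ← Finsupp.lapply_apply (R := 𝓡), map_finsum (Finsupp.lapply S) hg]
  rfl

theorem transpose_neg (A : Module.End 𝓡 (FinFock 𝓡)) (v : Fock k) :
    transpose (-A) v = -transpose A v := by
  funext S
  simp [transpose]

/-- For distinct indices the two fermions anticommute, so normal ordering introduces no constant.
This suffices, since only currents of nonzero index occur. -/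
theorem normalOrdered_eq_transpose {i j : ℤ} (hij : i ≠ j) (v : Fock k) :
    normalOrdered i j v = transpose (cre j * contr i) v := by
  unfold normalOrdered
  split_ifs
  · rw [psiStar_eq_transpose, psi_eq_transpose, transpose_transpose, contr_mul_cre_of_ne hij,
      transpose_neg, neg_neg]
  · rw [psiStar_eq_transpose, psi_eq_transpose, transpose_transpose]

theorem normalOrdered_coe {i j : ℤ} (hij : i ≠ j) (w : FinFock 𝓡) :
    normalOrdered i j ⇑w = ⇑((cre i * contr j : Module.End 𝓡 (FinFock 𝓡)) w) := by
  unfold normalOrdered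
  split_ifs
  · rw [psi_coe, psiStar_coe, ← Module.End.mul_apply, contr_mul_cre_of_ne hij.symm,
      LinearMap.neg_apply, Finsupp.coe_neg, neg_neg]
  · rw [psiStar_coe, psi_coe, Module.End.mul_apply]

/-- The power series `∑_m (-1)^{m-1} β^m z^m / m = log(1 + β z)`. -/
def thetaSeries (β : k) : PowerSeries 𝓡 :=
  PowerSeries.X * PowerSeries.mk fun m =>
    algebraMap k 𝓡 ((-1) ^ m * β ^ (m + 1) / ((m + 1 : ℕ) : k))

theorem constantCoeff_thetaSeries (β : k) : constantCoeff (thetaSeries β) = 0 := by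
  simp [thetaSeries]

theorem coeff_thetaSeries (β : k) (m : ℕ) : coeff (m + 1) (thetaSeries β) =
    algebraMap k 𝓡 ((-1) ^ m * β ^ (m + 1) / ((m + 1 : ℕ) : k)) := by
  rw [thetaSeries, coeff_succ_X_mul, coeff_mk]

/-- The power series `∑_m p_m(x) z^m / m`. -/
def powerSumSeries (k : Type*) [Field k] : PowerSeries (MvPowerSeries ℕ k) :=
  PowerSeries.X * PowerSeries.mk fun m => ((m + 1 : ℕ) : k)⁻¹ • powerSum (k := k) (m + 1)

theorem constantCoeff_powerSumSeries : constantCoeff (powerSumSeries k) = 0 := by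
  simp [powerSumSeries]

theorem coeff_powerSumSeries (m : ℕ) : coeff (m + 1) (powerSumSeries k) =
    ((m + 1 : ℕ) : k)⁻¹ • powerSum (k := k) (m + 1) := by
  rw [powerSumSeries, coeff_succ_X_mul, coeff_mk]

theorem current_neg_apply (m : ℕ) (v : Fock k) (S : Maya) :
    current (-((m : ℤ) + 1)) v S = pair v (∑ᶠ i, moveDown (m, i) (basisVector 𝓡 S)) := by
  have hfin := hasFiniteSupport_prodMk (hasFiniteSupport_moveDown (basisVector 𝓡 S)) m
  have h : ∀ i : ℤ, normalOrdered i (i + -((m : ℤ) + 1)) v S =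
      pair v (moveDown (m, i) (basisVector 𝓡 S)) := fun i => by
    rw [normalOrdered_eq_transpose (by omega), ← sub_eq_add_neg]
    rfl
  rw [current, formalSum_apply, map_finsum (pair v) hfin, finsum_congr h]
  exact hfin.subset fun i hi h' => hi (by simp only [h, h', map_zero])

/-- Θ moves particles up by arbitrary distances and does not preserve finite vectors; its transpose
moves them down, so local nilpotency becomes available. -/
theorem opTheta_eq_transpose (β : k) (v : Fock k) :
    opTheta β v = transpose (lower (thetaSeries β)) v := by
  funext S
  have hfin := hasFiniteSupport_moveDown (basisVector 𝓡 S)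
  have hfin' := hasFiniteSupport_smul_moveDown (thetaSeries β) (basisVector 𝓡 S)
  have h : ∀ m : ℕ, (((-1) ^ m * β ^ (m + 1) / ((m + 1 : ℕ) : k)) • current (-((m : ℤ) + 1)) v) S =
      pair v (∑ᶠ i, coeff (m + 1) (thetaSeries β) • moveDown (m, i) (basisVector 𝓡 S)) := by
    intro m
    rw [Pi.smul_apply, current_neg_apply, ← smul_finsum' _ (hasFiniteSupport_prodMk hfin m),
      map_smul, coeff_thetaSeries, algebraMap_smul]
  rw [opTheta, formalSum_apply, finsum_congr h, transpose, lower_apply, finsum_curry _ hfin',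
    map_finsum (pair v) (hasFiniteSupport_finsum hfin')]
  refine (hasFiniteSupport_finsum hfin').subset fun m hm h' => hm ?_
  simp only at h' ⊢
  rw [h, h', map_zero]

theorem current_coe (m : ℕ) (w : FinFock 𝓡) :
    current ((m : ℤ) + 1) ⇑w = ⇑(∑ᶠ i, moveDown (m, i) w) := by
  have hfin := hasFiniteSupport_prodMk (hasFiniteSupport_moveDown w) m
  -- The current is indexed by the target of a move and `moveDown` by its source, hence the
  -- translation by m + 1.
  have h : ∀ i : ℤ, normalOrdered i (i + ((m : ℤ) + 1)) ⇑w =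
      ⇑(moveDown (m, Equiv.addRight ((m : ℤ) + 1) i) w) := fun i => by
    rw [normalOrdered_coe (by omega)]
    simp [moveDown, add_assoc]
  simp only [current, h]
  rw [formalSum_coe (hfin.preimage (Equiv.injective _).injOn),
    finsum_comp_equiv (f := fun i => moveDown (m, i) w)]

theorem opH_coe (w : FinFock 𝓡) : opH ⇑w = ⇑(lower (powerSumSeries k) w) := by
  have hfin := hasFiniteSupport_moveDown w
  have hfin' := hasFiniteSupport_smul_moveDown (powerSumSeries k) w
  have h : ∀ m : ℕ, (((m + 1 : ℕ) : k)⁻¹ • powerSum (k := k) (m + 1)) • current ((m : ℤ) + 1) ⇑w =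
      ⇑(∑ᶠ i, coeff (m + 1) (powerSumSeries k) • moveDown (m, i) w) := by
    intro m
    rw [current_coe, ← smul_finsum' _ (hasFiniteSupport_prodMk hfin m), coeff_powerSumSeries,
      Finsupp.coe_smul]
  simp only [opH, h]
  rw [formalSum_coe (hasFiniteSupport_finsum hfin'), lower_apply, finsum_curry _ hfin']

variable [CharZero k]

theorem expOp_eq_transpose {T : Fock k → Fock k} {A : Module.End 𝓡 (FinFock 𝓡)}
    (hA : LocallyNilpotent A) (hT : ∀ v, T v = transpose A v) (v : Fock k) :
    expOp T v = transpose (locExpEnd A hA) v := by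
  have hpow : ∀ (j : ℕ) (v : Fock k), T^[j] v = transpose (A ^ j) v := by
    intro j
    induction j with
    | zero =>
      intro v
      funext S
      exact (pair_basisVector v S).symm
    | succ j ih =>
      intro v
      rw [Function.iterate_succ_apply, ih, hT, transpose_transpose, ← pow_succ']
  have h : ∀ j : ℕ, ((j.factorial : k)⁻¹) • T^[j] v =
      transpose (algebraMap ℚ 𝓡 ((j.factorial : ℚ)⁻¹) • A ^ j) v := by
    intro j
    funext S
    rw [hpow, Pi.smul_apply, transpose, transpose, LinearMap.smul_apply, map_smul, algebraMap_smul,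
      inv_natCast_smul_eq k ℚ]
  simp only [expOp, h]
  refine formalSum_transpose (fun S => ?_) (fun S => ?_) v
  · obtain ⟨N, hN⟩ := hA (basisVector 𝓡 S)
    refine (Set.finite_Iio N).subset fun j hj => Set.mem_Iio.mpr (not_le.mp fun h' => hj ?_)
    simp only [LinearMap.smul_apply]
    rw [pow_apply_eq_zero_of_le hN h', smul_zero]
  · refine finsum_congr fun j => ?_
    rw [LinearMap.smul_apply, algebraMap_smul]

theorem expOp_coe {T : Fock k → Fock k} {A : Module.End 𝓡 (FinFock 𝓡)}
    (hA : LocallyNilpotent A) (hT : ∀ w : FinFock 𝓡, T ⇑w = ⇑(A w)) (w : FinFock 𝓡) :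
    expOp T ⇑w = ⇑(locExp A w) := by
  have hpow : ∀ j : ℕ, T^[j] ⇑w = ⇑((A ^ j) w) := by
    intro j
    induction j with
    | zero => rfl
    | succ j ih => rw [Function.iterate_succ_apply', ih, hT, pow_succ', Module.End.mul_apply]
  have h : ∀ j : ℕ, ((j.factorial : k)⁻¹) • T^[j] ⇑w = ⇑(((j.factorial : ℚ)⁻¹) • (A ^ j) w) := by
    intro j
    rw [hpow, Finsupp.coe_smul, inv_natCast_smul_eq k ℚ]
  simp only [expOp, h]
  obtain ⟨N, hN⟩ := hA w
  refine formalSum_coe ((Set.finite_Iio N).subset fun j hj =>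
    Set.mem_Iio.mpr (not_le.mp fun h' => hj ?_))
  simp only
  rw [pow_apply_eq_zero_of_le hN h', smul_zero]

theorem expOp_opH_coe (w : FinFock 𝓡) :
    expOp opH ⇑w = ⇑(locExp (lower (powerSumSeries k)) w) :=
  expOp_coe (locallyNilpotent_lower _) opH_coe w

theorem expTheta_eq_transpose (β : k) (s : ℤ) (v : Fock k) :
    expTheta β s v = transpose (locExpEnd ((s : 𝓡) • lower (thetaSeries β))
      ((locallyNilpotent_lower _).smul _)) v := by
  refine expOp_eq_transpose _ (fun v => ?_) v
  funext S
  rw [Pi.smul_apply, opTheta_eq_transpose, transpose, transpose, LinearMap.smul_apply, map_smul,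
    ← map_intCast (algebraMap k 𝓡), algebraMap_smul]

theorem expTheta_expTheta (β : k) (s t : ℤ) (v : Fock k) :
    expTheta β s (expTheta β t v) = expTheta β (s + t) v := by
  simp only [expTheta_eq_transpose, transpose_transpose]
  congr 1
  ext1 S
  ext1
  simp only [LinearMap.comp_apply, Module.End.mul_apply, locExpEnd_apply]
  rw [locExp_add_smul (locallyNilpotent_lower _), add_comm s t, Int.cast_add]

theorem derivative_thetaSeries_mul (β : k) :
    d⁄dX 𝓡 (thetaSeries β) * (1 + PowerSeries.C (algebraMap k 𝓡 β) * PowerSeries.X) =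
      PowerSeries.C (algebraMap k 𝓡 β) := by
  have h : ∀ m, coeff m (d⁄dX 𝓡 (thetaSeries β)) = algebraMap k 𝓡 ((-1) ^ m * β ^ (m + 1)) := by
    intro m
    have hm : ((m + 1 : ℕ) : k) ≠ 0 := Nat.cast_ne_zero.mpr m.succ_ne_zero
    rw [coeff_derivative, coeff_thetaSeries, ← Nat.cast_succ, ← map_natCast (algebraMap k 𝓡),
      ← map_mul, div_mul_cancel₀ _ hm]
  ext1 m
  rw [mul_add, mul_one, mul_left_comm, map_add, coeff_C_mul, h, coeff_C]
  rcases m with _ | m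
  · simp
  · rw [coeff_succ_mul_X, h, ← map_mul, ← map_add, if_neg m.succ_ne_zero, pow_succ (-1 : k)]
    convert map_zero (algebraMap k 𝓡)
    ring

/-- `exp(s log(1 + β z)) = (1 + β z)^s`. -/
theorem expSeries_thetaSeries (β : k) (s : ℕ) :
    expSeries ((s : 𝓡) • thetaSeries β) =
      (1 + PowerSeries.C (algebraMap k 𝓡 β) * PowerSeries.X) ^ s := by
  have hc : constantCoeff ((s : 𝓡) • thetaSeries β) = 0 := by
    rw [← coeff_zero_eq_constantCoeff_apply, map_smul, coeff_zero_eq_constantCoeff_apply,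
      constantCoeff_thetaSeries, smul_zero]
  refine expSeries_eq_of_derivative hc (by simp) ?_
  rcases s with _ | s
  · simp
  rw [derivative_pow, Nat.add_sub_cancel, pow_succ, Derivation.map_smul, smul_mul_assoc,
    mul_left_comm,
    derivative_thetaSeries_mul, map_add, derivative_one, Derivation.leibniz, derivative_C,
    derivative_X]
  simp [smul_eq_C_mul, mul_assoc]

theorem coeff_one_add_C_mul_X_pow {A : Type*} [CommRing A] (b : A) (s m : ℕ) :
    coeff m ((1 + PowerSeries.C b * PowerSeries.X) ^ s : PowerSeries A) = s.choose m * b ^ m := by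
  have : (1 + PowerSeries.C b * PowerSeries.X : PowerSeries A) ^ s =
      rescale b ((((1 + Polynomial.X) ^ s : Polynomial A)) : PowerSeries A) := by
    simp
  rw [this, coeff_rescale, Polynomial.coeff_coe, Polynomial.coeff_one_add_X_pow, mul_comm]

/-- After transposing, this is the conjugation of ψ*_n by the exponential of a lowering operator.
The minus sign of the exponent cancels that of the commutator, so the factor is (1 + βz)^s, a
polynomial, and the sum is finite. -/
theorem psi_expTheta (β : k) (n : ℤ) (s : ℕ) (v : Fock k) :
    psi n (expTheta β (-(s : ℤ)) v) = expTheta β (-(s : ℤ))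
      (∑ m ∈ Finset.range (s + 1), ((s.choose m : 𝓡) * algebraMap k 𝓡 β ^ m) • psi (n + m) v) := by
  have hc : constantCoeff ((s : 𝓡) • thetaSeries β) = 0 := by
    rw [← coeff_zero_eq_constantCoeff_apply, map_smul, coeff_zero_eq_constantCoeff_apply,
      constantCoeff_thetaSeries, smul_zero]
  have hcomm : ∀ (j : ℕ) (w : FinFock 𝓡),
      (((-(s : ℤ) : ℤ) : 𝓡) • lower (thetaSeries β)) (contr (n + j) w) =
        contr (n + j) ((((-(s : ℤ) : ℤ) : 𝓡) • lower (thetaSeries β)) w) +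
          ∑ᶠ l : ℕ, coeff l ((s : 𝓡) • thetaSeries β) • contr (n + ((j + l : ℕ) : ℤ)) w := by
    intro j w
    have h := eq_sub_of_add_eq (contr_lower (constantCoeff_thetaSeries β) (n + j) w).symm
    have hfin : Function.HasFiniteSupport fun l : ℕ =>
        coeff l (thetaSeries β) • contr (n + j + (l : ℤ)) w := by
      obtain ⟨K, hK⟩ := locallyFinite_contr (n + j) w
      refine (Set.finite_Iio K).subset fun l hl => Set.mem_Iio.mpr (not_le.mp fun h' => hl ?_)
      simp only
      rw [hK l h', smul_zero]
    rw [LinearMap.smul_apply, LinearMap.smul_apply, map_smul, h, smul_sub, Int.cast_neg,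
      Int.cast_natCast, neg_smul, neg_smul, sub_neg_eq_add, smul_finsum' _ hfin]
    congr 1
    refine finsum_congr fun l => ?_
    rw [map_smul, smul_assoc, Nat.cast_add, add_assoc]
  have hsum : ∀ w : FinFock 𝓡, seriesAction (fun m : ℕ => contr (n + m)) (locallyFinite_contr n)
      ((1 + PowerSeries.C (algebraMap k 𝓡 β) * PowerSeries.X) ^ s) w =
      ∑ m ∈ Finset.range (s + 1),
        ((s.choose m : 𝓡) * algebraMap k 𝓡 β ^ m) • contr (n + m) w := by
    intro w
    rw [seriesAction_apply, finsum_eq_sum_range (K := s + 1)]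
    · simp only [coeff_one_add_C_mul_X_pow]
    · intro m hm
      rw [coeff_one_add_C_mul_X_pow, Nat.choose_eq_zero_of_lt hm, Nat.cast_zero, zero_mul,
        zero_smul]
  have hone : ∀ w : FinFock 𝓡, seriesAction (fun m : ℕ => contr (n + m)) (locallyFinite_contr n)
      1 w = contr n w := by
    intro w
    rw [seriesAction_apply,
      finsum_eq_single _ 0 fun m hm => by rw [coeff_one, if_neg hm, zero_smul]]
    simp
  have hpsi : ∑ m ∈ Finset.range (s + 1),
      ((s.choose m : 𝓡) * algebraMap k 𝓡 β ^ m) • psi (n + m) v =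
      transpose (∑ m ∈ Finset.range (s + 1),
        ((s.choose m : 𝓡) * algebraMap k 𝓡 β ^ m) • contr (n + m)) v := by
    funext S
    simp only [psi_eq_transpose, transpose, LinearMap.sum_apply, LinearMap.smul_apply, map_sum,
      map_smul, Finset.sum_apply, Pi.smul_apply]
  rw [hpsi, expTheta_eq_transpose, expTheta_eq_transpose, psi_eq_transpose, transpose_transpose,
    transpose_transpose]
  congr 1
  refine LinearMap.ext fun w => ?_
  rw [Module.End.mul_apply, Module.End.mul_apply, locExpEnd_apply, locExpEnd_apply, ← hone,
    locExp_seriesAction (locallyFinite_contr n) ((locallyNilpotent_lower _).smul _) hc hcomm,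
    mul_one, expSeries_thetaSeries, hsum, LinearMap.sum_apply]
  simp only [LinearMap.smul_apply]

end Operators

/-! ### The shifted vacua -/

section ShiftedVacuum

variable {R : Type*} [CommRing R]

/-- The set of sites `{i | i < -r}` occupied in `|-r⟩`. -/
def Maya.shifted (r : ℕ) : Maya :=
  ⟨{i : ℤ | i < -(r : ℤ)},
    Set.finite_empty.subset (fun i hi => by
      have h1 : 0 ≤ i := hi.1
      have h2 : i < -(r : ℤ) := hi.2
      omega),
    (Set.finite_Ico (-(r : ℤ)) 0).subset (fun i hi => by
      have h1 : i < 0 := hi.1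
      have h2 : ¬i < -(r : ℤ) := hi.2
      exact Set.mem_Ico.mpr ⟨not_lt.mp h2, h1⟩)⟩

theorem Maya.mem_shifted {r : ℕ} {i : ℤ} : i ∈ (Maya.shifted r).1 ↔ i < -(r : ℤ) := Iff.rfl

theorem Maya.shifted_zero : Maya.shifted 0 = Maya.vacuum :=
  Maya.ext fun i => by rw [Maya.mem_shifted]; simp [Maya.vacuum]

theorem Maya.insert_shifted_succ (r : ℕ) :
    (Maya.shifted (r + 1)).insert (-((r : ℤ) + 1)) = Maya.shifted r :=
  Maya.ext fun i => by
    rw [Maya.mem_insert, Maya.mem_shifted, Maya.mem_shifted]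
    push_cast
    omega

theorem Maya.notMem_shifted_succ (r : ℕ) : -((r : ℤ) + 1) ∉ (Maya.shifted (r + 1)).1 := by
  rw [Maya.mem_shifted]
  push_cast
  omega

theorem Maya.sign_shifted_succ (r : ℕ) : (Maya.shifted (r + 1)).sign (-((r : ℤ) + 1)) = 1 := by
  have : {i : ℤ | i ∈ (Maya.shifted (r + 1)).1 ∧ -((r : ℤ) + 1) < i} = ∅ :=
    Set.eq_empty_of_forall_notMem fun i hi => by
      have h1 := Maya.mem_shifted.mp hi.1
      have h2 : -((r : ℤ) + 1) < i := hi.2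
      push_cast at h1
      omega
  rw [Maya.sign, this, Set.ncard_empty, pow_zero]

theorem cre_shifted_succ (r : ℕ) : cre (-((r : ℤ) + 1)) (basisVector R (Maya.shifted (r + 1))) =
    basisVector R (Maya.shifted r) := by
  rw [cre_basisVector (Maya.notMem_shifted_succ r), Maya.sign_shifted_succ,
    Maya.insert_shifted_succ, one_smul]

theorem contr_shifted (r : ℕ) : contr (-((r : ℤ) + 1)) (basisVector R (Maya.shifted r)) =
    basisVector R (Maya.shifted (r + 1)) := by
  rw [← Maya.insert_shifted_succ, contr_basisVector_insert (Maya.notMem_shifted_succ r),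
    Maya.sign_shifted_succ, one_smul]

theorem shiftedVacuum_eq_coe {k : Type*} [Field k] (r : ℕ) :
    (shiftedVacuum r : Fock k) = ⇑(basisVector (MvPowerSeries ℕ k) (Maya.shifted r)) := by
  induction r with
  | zero =>
    funext S
    classical
    rw [shiftedVacuum, vacuum, basisVector, Maya.shifted_zero, Finsupp.single_apply]
    exact if_congr eq_comm rfl rfl
  | succ r ih => rw [shiftedVacuum, ih, psiStar_coe, contr_shifted]

theorem cre_shifted_of_lt {r : ℕ} {n : ℤ} (h : n < -(r : ℤ)) :
    cre n (basisVector R (Maya.shifted r)) = 0 :=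
  cre_basisVector_of_mem h

/-- No empty site lies below an occupied one, so no particle can move down. -/
theorem lower_shifted (c : PowerSeries R) (r : ℕ) :
    lower c (basisVector R (Maya.shifted r)) = 0 := by
  rw [lower_apply]
  refine finsum_eq_zero_of_forall_eq_zero fun p => ?_
  rcases moveDown_basisVector (R := R) p (Maya.shifted r) with h | ⟨h1, h2, -⟩
  · rw [h, smul_zero]
  · rw [Maya.mem_shifted] at h1 h2
    omega

theorem cre_apply_of_notMem {n : ℤ} {T : Maya} (h : n ∉ T.1) (w : FinFock R) : cre n w T = 0 := by
  induction w using FinFock.induction with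
  | zero => simp
  | add v w hv hw => rw [map_add, Finsupp.add_apply, hv, hw, add_zero]
  | basis c S =>
    rw [map_smul, Finsupp.smul_apply, ← contr_basisVector_apply, contr_basisVector_of_notMem h,
      Finsupp.coe_zero, Pi.zero_apply, smul_zero]

end ShiftedVacuum

/-! ### Wick's theorem and the conjugation of fermions by H -/

section Wick

open PowerSeries

variable {R : Type*} [CommRing R]

/-- Exterior multiplication by the vector `∑ a_n v_n`. -/
def creVec : (ℤ →₀ R) →ₗ[R] Module.End R (FinFock R) := Finsupp.linearCombination R cre

theorem creVec_single (n : ℤ) (c : R) : creVec (Finsupp.single n c) = c • cre n := by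
  simp [creVec]

theorem creVec_creVec (a b : ℤ →₀ R) (w : FinFock R) :
    creVec a (creVec b w) = -creVec b (creVec a w) := by
  induction a using Finsupp.induction_linear with
  | zero => simp
  | add a a' ha ha' =>
    rw [map_add, LinearMap.add_apply, LinearMap.add_apply, map_add, ha, ha', neg_add]
  | single n c =>
    induction b using Finsupp.induction_linear with
    | zero => simp
    | add b b' hb hb' =>
      rw [map_add, LinearMap.add_apply, LinearMap.add_apply, map_add, hb, hb', neg_add]
    | single m d =>
      simp only [creVec_single, LinearMap.smul_apply, map_smul]
      rw [← Module.End.mul_apply, cre_mul_cre, LinearMap.neg_apply, smul_neg, smul_neg, smul_comm]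
      rfl

theorem creVec_mul_self (a : ℤ →₀ R) : creVec a * creVec a = 0 := by
  refine LinearMap.ext fun w => ?_
  rw [Module.End.mul_apply, LinearMap.zero_apply]
  induction a using Finsupp.induction_linear with
  | zero => simp
  | add a b ha hb =>
    simp only [map_add, LinearMap.add_apply]
    rw [ha, hb, creVec_creVec a b]
    abel
  | single n c =>
    simp only [creVec_single, LinearMap.smul_apply, map_smul]
    rw [← Module.End.mul_apply, cre_mul_self, LinearMap.zero_apply, smul_zero, smul_zero]

/-- The alternating map `(a_1, …, a_r) ↦ ⟨0| ψ(a_1) ⋯ ψ(a_r) |-r⟩`. -/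
def vacuumExpectation (R : Type*) [CommRing R] (r : ℕ) : (ℤ →₀ R) [⋀^Fin r]→ₗ[R] R :=
  (Finsupp.lapply Maya.vacuum ∘ₗ LinearMap.applyₗ (basisVector R (Maya.shifted r)) ∘ₗ
    (ExteriorAlgebra.lift R ⟨creVec, creVec_mul_self⟩).toLinearMap).compAlternatingMap
      (ExteriorAlgebra.ιMulti R r)

theorem vacuumExpectation_apply {r : ℕ} (a : Fin r → ℤ →₀ R) :
    vacuumExpectation R r a =
      (List.ofFn fun i => creVec (a i)).prod (basisVector R (Maya.shifted r)) Maya.vacuum := by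
  simp only [vacuumExpectation, LinearMap.compAlternatingMap_apply, LinearMap.comp_apply,
    AlgHom.toLinearMap_apply, ExteriorAlgebra.ιMulti_apply, map_list_prod, List.map_ofFn,
    Function.comp_def, ExteriorAlgebra.lift_ι_apply]
  rfl

theorem vacuumExpectation_eq_zero_of_perm {r : ℕ} {a : Fin r → ℤ →₀ R} (σ : Equiv.Perm (Fin r))
    (h : vacuumExpectation R r (a ∘ σ) = 0) : vacuumExpectation R r a = 0 := by
  rw [AlternatingMap.map_perm] at h
  exact (smul_eq_zero_iff_eq _).mp h

/-- By alternation the argument moves to the front, where ⟨0|ψ_n = 0. -/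
theorem vacuumExpectation_eq_zero_of_nonneg {r : ℕ} {a : Fin r → ℤ →₀ R} {i : Fin r} {n : ℤ}
    (hn : 0 ≤ n) (h : a i = Finsupp.single n 1) : vacuumExpectation R r a = 0 := by
  rcases r with _ | r
  · exact i.elim0
  refine vacuumExpectation_eq_zero_of_perm (Equiv.swap 0 i) ?_
  rw [vacuumExpectation_apply, List.ofFn_succ, List.prod_cons, Module.End.mul_apply,
    Function.comp_apply, Equiv.swap_apply_left, h, creVec_single, one_smul]
  exact cre_apply_of_notMem (fun h => not_lt.mpr hn h) _

/-- By alternation the argument moves to the end, where ψ_n|-r⟩ = 0. -/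
theorem vacuumExpectation_eq_zero_of_lt {r : ℕ} {a : Fin r → ℤ →₀ R} {i : Fin r} {n : ℤ}
    (hn : n < -(r : ℤ)) (h : a i = Finsupp.single n 1) : vacuumExpectation R r a = 0 := by
  rcases r with _ | r
  · exact i.elim0
  refine vacuumExpectation_eq_zero_of_perm (Equiv.swap (Fin.last r) i) ?_
  rw [vacuumExpectation_apply, List.ofFn_succ', List.concat_eq_append, List.prod_append,
    List.prod_singleton, Module.End.mul_apply, Function.comp_apply, Equiv.swap_apply_left, h,
    creVec_single, one_smul, cre_shifted_of_lt hn, map_zero, Finsupp.coe_zero, Pi.zero_apply]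

theorem prod_cre_shifted (r : ℕ) :
    (List.ofFn fun i : Fin r => (cre (-((i : ℤ) + 1)) : Module.End R _)).prod
      (basisVector R (Maya.shifted r)) = basisVector R Maya.vacuum := by
  induction r with
  | zero => simp [Maya.shifted_zero]
  | succ r ih =>
    rw [List.ofFn_succ', List.concat_eq_append, List.prod_append, List.prod_singleton,
      Module.End.mul_apply, Fin.val_last, cre_shifted_succ]
    exact ih

/-- Wick's theorem: `⟨0| ψ(a_1) ⋯ ψ(a_r) |-r⟩ = det (a_i)_{-j}`. -/
theorem vacuumExpectation_eq_det {r : ℕ} (a : Fin r → ℤ →₀ R) :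
    vacuumExpectation R r a = Matrix.det (Matrix.of fun i j : Fin r => a i (-((j : ℤ) + 1))) := by
  let π : (ℤ →₀ R) →ₗ[R] Fin r → R := LinearMap.pi fun j => Finsupp.lapply (-((j : ℤ) + 1))
  suffices h : vacuumExpectation R r =
      (Matrix.detRowAlternating (n := Fin r) (R := R)).compLinearMap π by
    rw [h]
    rfl
  -- Both sides are alternating, so distinct basis vectors suffice. If some index lies outside [-r,
  -- -1], both sides vanish; otherwise the `r` distinct indices permute that window, and both sides
  -- reduce to the value 1.
  refine Module.Basis.ext_alternating (Finsupp.basisSingleOne (R := R) (ι := ℤ)) fun v hv => ?_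
  simp only [Finsupp.coe_basisSingleOne]
  by_cases hout : ∃ i, 0 ≤ v i ∨ v i < -(r : ℤ)
  · obtain ⟨i, hi⟩ := hout
    have h0 : (Matrix.detRowAlternating (n := Fin r) (R := R)).compLinearMap π
        (fun i => Finsupp.single (v i) 1) = 0 := by
      refine Matrix.det_eq_zero_of_row_eq_zero i fun j => ?_
      have : v i ≠ -((j : ℤ) + 1) := by have := j.2; omega
      exact Finsupp.single_eq_of_ne this.symm
    rw [h0]
    rcases hi with hi | hi
    · exact vacuumExpectation_eq_zero_of_nonneg hi (i := i) rfl
    · exact vacuumExpectation_eq_zero_of_lt hi (i := i) rfl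
  · push Not at hout
    let f : Fin r → Fin r := fun i => ⟨(-(v i) - 1).toNat, by have := hout i; omega⟩
    have hf : ∀ i, v i = -((f i : ℤ) + 1) := fun i => by
      have := hout i
      simp only [f]
      omega
    have hinj : Function.Injective f := fun i j hij => hv (by rw [hf i, hf j, hij])
    let σ : Equiv.Perm (Fin r) := Equiv.ofBijective f (Finite.injective_iff_bijective.mp hinj)
    have hσ : (fun i => Finsupp.single (v i) (1 : R)) =
        (fun j : Fin r => Finsupp.single (-((j : ℤ) + 1)) (1 : R)) ∘ σ := by
      funext i
      simp [σ, hf]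
    rw [hσ, AlternatingMap.map_perm, AlternatingMap.map_perm]
    congr 1
    have h1 : (Matrix.detRowAlternating (n := Fin r) (R := R)).compLinearMap π
        (fun j : Fin r => Finsupp.single (-((j : ℤ) + 1)) (1 : R)) = 1 := by
      refine Eq.trans ?_ (Matrix.det_one (n := Fin r) (R := R))
      refine congrArg Matrix.det (Matrix.ext fun i j => ?_)
      simp [π, Finsupp.single_apply, Matrix.one_apply, Fin.ext_iff]
    rw [h1, vacuumExpectation_apply]
    simp only [creVec_single, one_smul]
    rw [prod_cre_shifted]
    simp [basisVector]

/-- The coefficient of `z^n` for an integer `n`, equal to `0` for `n < 0`. -/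
def intCoeff (h : R⟦X⟧) (n : ℤ) : R := if 0 ≤ n then coeff n.toNat h else 0

/-- The action `v_n ↦ ∑_m h_m v_{n-m}` of a power series, with the `v_n`, `n < -r`, set to `0`. -/
def toeplitz (h : R⟦X⟧) (r : ℕ) : (ℤ →₀ R) →ₗ[R] (ℤ →₀ R) :=
  Finsupp.linearCombination R fun n =>
    -- The range consists of the m ≥ 0 with n - m ≥ -r; it is empty for n < -r.
    ∑ m ∈ Finset.range (n + r + 1).toNat, Finsupp.single (n - m) (coeff m h)

theorem toeplitz_single_apply (h : R⟦X⟧) {r j : ℕ} (hj : j < r) (n : ℤ) :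
    toeplitz h r (Finsupp.single n 1) (-((j : ℤ) + 1)) = intCoeff h (n + (j + 1)) := by
  rw [toeplitz, Finsupp.linearCombination_single, one_smul, Finsupp.finsetSum_apply, intCoeff]
  split_ifs with hn
  · rw [Finset.sum_eq_single (n + (j + 1)).toNat]
    · rw [Finsupp.single_apply, if_pos (by omega)]
    · intro m _ hm
      rw [Finsupp.single_apply, if_neg (by omega)]
    · intro hm
      rw [Finset.mem_range] at hm
      omega
  · refine Finset.sum_eq_zero fun m _ => ?_
    rw [Finsupp.single_apply, if_neg (by omega)]

/-- Conjugation turns ψ_n into ∑ h_m ψ_{n-m} with h = e^c. The terms with n - m < -r, dropped by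
`toeplitz`, vanish by `hw`. -/
theorem locExp_lower_creVec [Algebra ℚ R] {c : R⟦X⟧} (hc : constantCoeff c = 0) {r : ℕ}
    {w : FinFock R} (hw : ∀ n < -(r : ℤ), cre n (locExp (lower c) w) = 0) (a : ℤ →₀ R) :
    locExp (lower c) (creVec a w) =
      creVec (toeplitz (expSeries c) r a) (locExp (lower c) w) := by
  have hN := locallyNilpotent_lower c
  suffices h : locExpEnd (lower c) hN ∘ₗ LinearMap.applyₗ w ∘ₗ creVec =
      LinearMap.applyₗ (locExp (lower c) w) ∘ₗ creVec ∘ₗ toeplitz (expSeries c) r from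
    LinearMap.congr_fun h a
  refine Finsupp.lhom_ext' fun n => LinearMap.ext_ring ?_
  simp only [LinearMap.comp_apply, Finsupp.lsingle_apply, creVec_single, one_smul,
    LinearMap.applyₗ_apply_apply, locExpEnd_apply]
  have hone : cre n w = seriesAction (fun m : ℕ => cre (n - m)) (locallyFinite_cre n) 1 w := by
    rw [seriesAction_apply,
      finsum_eq_single _ 0 fun m hm => by rw [coeff_one, if_neg hm, zero_smul]]
    simp
  rw [hone, locExp_seriesAction (locallyFinite_cre n) hN hc, mul_one,
    seriesAction_eq_sum _ (K := (n + r + 1).toNat) fun m hm => hw _ (by omega), toeplitz,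
    Finsupp.linearCombination_single, one_smul, map_sum, LinearMap.sum_apply]
  · simp only [creVec_single, LinearMap.smul_apply]
  · intro j w
    rw [lower_cre hc]
    congr 1
    refine finsum_congr fun l => ?_
    rw [Nat.cast_add, sub_sub]

theorem cre_creVec_eq_zero {n : ℤ} {w : FinFock R} (h : cre n w = 0) (a : ℤ →₀ R) :
    cre n (creVec a w) = 0 := by
  have h1 : cre n = creVec (Finsupp.single n (1 : R)) := by rw [creVec_single, one_smul]
  rw [h1, creVec_creVec, ← h1, h, map_zero, neg_zero]

/-- The second conjunct is carried through the induction to justify the truncation at each further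
fermion. -/
theorem locExp_lower_prod_creVec [Algebra ℚ R] {c : R⟦X⟧} (hc : constantCoeff c = 0) (r : ℕ)
    (l : List (ℤ →₀ R)) :
    locExp (lower c) ((l.map creVec).prod (basisVector R (Maya.shifted r))) =
        ((l.map fun a => creVec (toeplitz (expSeries c) r a)).prod
          (basisVector R (Maya.shifted r))) ∧
      ∀ n < -(r : ℤ),
        cre n (((l.map fun a => creVec (toeplitz (expSeries c) r a)).prod
          (basisVector R (Maya.shifted r)))) = 0 := by
  induction l with
  | nil =>
    refine ⟨?_, fun n hn => cre_shifted_of_lt hn⟩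
    exact locExp_of_apply_eq_zero (lower_shifted c r)
  | cons a l ih =>
    simp only [List.map_cons, List.prod_cons, Module.End.mul_apply]
    refine ⟨?_, fun n hn => cre_creVec_eq_zero (ih.2 n hn) _⟩
    rw [locExp_lower_creVec hc (by rw [ih.1]; exact ih.2), ih.1]

end Wick

/-! ### The fermionic expression as a determinant -/

section FermionicG

variable {k : Type*} [Field k] [CharZero k]

theorem expTheta_zero (β : k) (v : Fock k) : expTheta β 0 v = v := by
  rw [expTheta_eq_transpose]
  funext S
  rw [transpose, locExpEnd_apply, locExp_of_apply_eq_zero (by simp), pair_basisVector]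

/-- The exponentials telescope: next to the innermost fermion, of index `i`, one e^Θ turns
e^{-(i+1)Θ} into e^{-iΘ}, which passes to the left through that fermion and meets the next e^Θ.
Hence the binomial coefficients of order `i`. -/
theorem foldr_psi_expTheta (β : k) (ν : ℕ → ℤ) (r : ℕ) (v : Fock k) :
    (List.range r).foldr (fun i v => psi (ν i) (expTheta β 1 v)) (expTheta β (-(r : ℤ)) v) =
      (List.range r).foldr (fun i v => ∑ m ∈ Finset.range (i + 1),
        ((i.choose m : MvPowerSeries ℕ k) * algebraMap k _ β ^ m) • psi (ν i + m) v) v := by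
  induction r generalizing v with
  | zero => simpa using expTheta_zero β v
  | succ r ih =>
    rw [List.range_succ, List.foldr_append, List.foldr_append, List.foldr_cons, List.foldr_nil,
      List.foldr_cons, List.foldr_nil, expTheta_expTheta,
      show (1 : ℤ) + -((r + 1 : ℕ) : ℤ) = -(r : ℤ) by push_cast; ring, psi_expTheta, ih]

/-- The vector `(1 + β σ)^i v_n`, where `σ` is the shift `v_m ↦ v_{m+1}`. -/
def shiftPow {R : Type*} [CommRing R] (b : R) (i : ℕ) (n : ℤ) : ℤ →₀ R :=
  ∑ m ∈ Finset.range (i + 1), ((i.choose m : R) * b ^ m) • Finsupp.single (n + m) 1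

/-- The matrix with entries `∑_m binom(i, m) b^m h_{ν_i + m + j}`. -/
def jacobiTrudi {R : Type*} [CommRing R] (b : R) (h : PowerSeries R) (ν : ℕ → ℤ) (r : ℕ) :
    Matrix (Fin r) (Fin r) R :=
  Matrix.of fun i j => ∑ m ∈ Finset.range (i + 1),
    (((i : ℕ).choose m : R) * b ^ m) * intCoeff h (ν i + m + (j + 1))

theorem foldr_psi_coe {k : Type*} [Field k] (b : MvPowerSeries ℕ k) (ν : ℕ → ℤ) (l : List ℕ)
    (w : FinFock (MvPowerSeries ℕ k)) :
    (l.foldr (fun i v => ∑ m ∈ Finset.range (i + 1),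
      ((i.choose m : MvPowerSeries ℕ k) * b ^ m) • psi (ν i + m) v) ⇑w) =
      ⇑(((l.map fun i => shiftPow b i (ν i)).map creVec).prod w) := by
  induction l with
  | nil => rfl
  | cons i l ih =>
    rw [List.foldr_cons, ih, List.map_cons, List.map_cons, List.prod_cons, Module.End.mul_apply]
    simp only [shiftPow, map_sum, map_smul, creVec_single, one_smul, LinearMap.sum_apply,
      LinearMap.smul_apply, Finsupp.coe_finsetSum, Finsupp.coe_smul, psi_coe]

theorem toeplitz_shiftPow_apply {R : Type*} [CommRing R] (h : PowerSeries R) {r j : ℕ} (hj : j < r)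
    (b : R) (i : ℕ) (n : ℤ) :
    toeplitz h r (shiftPow b i n) (-((j : ℤ) + 1)) =
      ∑ m ∈ Finset.range (i + 1), ((i.choose m : R) * b ^ m) * intCoeff h (n + m + (j + 1)) := by
  simp only [shiftPow, map_sum, map_smul, Finsupp.finsetSum_apply, Finsupp.smul_apply,
    toeplitz_single_apply _ hj, smul_eq_mul]

theorem vacuum_prod_creVec_eq_det {R : Type*} [CommRing R] (a : ℕ → ℤ →₀ R) (r : ℕ) :
    (((List.range r).map fun i => creVec (a i)).prod (basisVector R (Maya.shifted r)))
        Maya.vacuum =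
      Matrix.det (Matrix.of fun i j : Fin r => a i (-((j : ℤ) + 1))) := by
  rw [← vacuumExpectation_eq_det fun i : Fin r => a i, vacuumExpectation_apply, List.ofFn_eq_map,
    ← List.map_coe_finRange_eq_range, List.map_map]
  rfl

/-- The determinant `det (∑_m binom(i, m) b^m h_{ρ_i - i + m + j})`, for row lengths `ρ`. -/
def jacobiTrudiDet {R : Type*} [CommRing R] (b : R) (h : PowerSeries R) (ρ : ℕ → ℕ) (r : ℕ) : R :=
  (jacobiTrudi b h (fun i => (ρ i : ℤ) - ((i : ℤ) + 1)) r).det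

theorem fermionicG_eq_expOp (β : k) (lam : YoungDiagram) (r : ℕ) :
    fermionicG β lam r = expOp opH (⇑((((List.range r).map fun i =>
      shiftPow (algebraMap k (MvPowerSeries ℕ k) β) i ((lam.rowLen i : ℤ) - ((i : ℤ) + 1))).map
        creVec).prod (basisVector (MvPowerSeries ℕ k) (Maya.shifted r)))) Maya.vacuum := by
  rw [← foldr_psi_coe _ fun i : ℕ => (lam.rowLen i : ℤ) - ((i : ℤ) + 1), ← foldr_psi_expTheta,
      ← shiftedVacuum_eq_coe]
  rfl

theorem fermionicG_eq_det (β : k) (lam : YoungDiagram) (r : ℕ) :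
    fermionicG β lam r =
      jacobiTrudiDet (algebraMap k _ β) (expSeries (powerSumSeries k)) lam.rowLen r := by
  rw [fermionicG_eq_expOp]
  refine (congrFun (expOp_opH_coe _) Maya.vacuum).trans ?_
  have h := (locExp_lower_prod_creVec (constantCoeff_powerSumSeries (k := k)) r
    ((List.range r).map fun i => shiftPow (algebraMap k (MvPowerSeries ℕ k) β) i
      ((lam.rowLen i : ℤ) - ((i : ℤ) + 1)))).1
  rw [List.map_map (f := fun i => shiftPow (algebraMap k (MvPowerSeries ℕ k) β) i
      ((lam.rowLen i : ℤ) - ((i : ℤ) + 1)))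
    (g := fun a => creVec (toeplitz (expSeries (powerSumSeries k)) r a))] at h
  refine (DFunLike.congr_fun h Maya.vacuum).trans ?_
  refine (vacuum_prod_creVec_eq_det (fun i => toeplitz (expSeries (powerSumSeries k)) r
    (shiftPow (algebraMap k (MvPowerSeries ℕ k) β) i ((lam.rowLen i : ℤ) - ((i : ℤ) + 1)))) r).trans
    ?_
  refine congrArg Matrix.det (Matrix.ext fun i j => ?_)
  exact toeplitz_shiftPow_apply _ j.2 _ _ _

end FermionicG

/-! ### From the Jacobi–Trudi type determinant to the bialternant -/

section Bialternant

open PowerSeries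

variable {A : Type*} [CommRing A]

theorem intCoeff_of_neg (h : A⟦X⟧) {n : ℤ} (hn : n < 0) : intCoeff h n = 0 :=
  if_neg (not_le.mpr hn)

theorem intCoeff_natCast (h : A⟦X⟧) (n : ℕ) : intCoeff h n = coeff n h := by
  rw [intCoeff, if_pos (Int.natCast_nonneg n), Int.toNat_natCast]

theorem coeff_mul_eq_sum_intCoeff (h : A⟦X⟧) {q : A⟦X⟧} {r : ℕ} (hq : ∀ n, r ≤ n → coeff n q = 0)
    (p : ℕ) :
    coeff p (h * q) = ∑ m ∈ Finset.range r, intCoeff h (p - m) * coeff m q := by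
  have h1 : coeff p (h * q) = ∑ m ∈ Finset.range (p + 1), intCoeff h (p - m) * coeff m q := by
    rw [mul_comm, coeff_mul,
      Finset.Nat.sum_antidiagonal_eq_sum_range_succ fun a b => coeff a q * coeff b h]
    refine Finset.sum_congr rfl fun m hm => ?_
    have := Finset.mem_range_succ_iff.mp hm
    rw [← Nat.cast_sub this, intCoeff_natCast, mul_comm]
  rw [h1, sum_eq_sum_range_of_le _ (le_max_left (p + 1) r),
    ← sum_eq_sum_range_of_le _ (le_max_right (p + 1) r)]
  · intro n hn
    rw [hq n hn, mul_zero]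
  · intro n hn
    rw [intCoeff_of_neg h (by omega), zero_mul]

theorem coeff_eq_pow_of_mul_eq_one {g : A⟦X⟧} {y : A} (h : g * (1 - C y * X) = 1) (p : ℕ) :
    coeff p g = y ^ p := by
  have h' : g = 1 + C y * (g * X) := by linear_combination h
  induction p with
  | zero =>
    rw [h', map_add, coeff_C_mul]
    simp
  | succ p ih =>
    rw [h', map_add, coeff_C_mul, coeff_succ_mul_X, ih, coeff_one, if_neg p.succ_ne_zero, zero_add,
      pow_succ']

theorem coeff_prod_one_sub_eq_zero {ι : Type*} (s : Finset ι) (y : ι → A) {n : ℕ}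
    (hn : s.card < n) : coeff n (∏ i ∈ s, (1 - C (y i) * X : A⟦X⟧)) = 0 := by
  have h : ∏ i ∈ s, (1 - C (y i) * X : A⟦X⟧) =
      ((∏ i ∈ s, (1 - Polynomial.C (y i) * Polynomial.X) : Polynomial A) : A⟦X⟧) := by
    rw [← Polynomial.coeToPowerSeries.ringHom_apply, map_prod]
    simp
  rw [h, Polynomial.coeff_coe]
  refine Polynomial.coeff_eq_zero_of_natDegree_lt (lt_of_le_of_lt ?_ hn)
  refine (Polynomial.natDegree_prod_le s _).trans ((Finset.sum_le_card_nsmul s _ 1 ?_).trans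
    (by simp))
  intro i _
  compute_degree

theorem sum_choose_mul_pow (b y : A) (i p : ℕ) :
    ∑ m ∈ Finset.range (i + 1), ((i.choose m : A) * b ^ m) * y ^ (p + m) =
      y ^ p * (1 + b * y) ^ i := by
  rw [add_comm 1, add_pow, Finset.mul_sum]
  refine Finset.sum_congr rfl fun m _ => ?_
  rw [mul_pow, one_pow, pow_add]
  ring

/-- The matrix of coefficients of the polynomials `∏_{i ≠ l} (1 - y_i z)`. -/
def omittedMatrix {r : ℕ} (y : Fin r → A) : Matrix (Fin r) (Fin r) A :=
  Matrix.of fun j l => coeff (r - 1 - j) (∏ i ∈ Finset.univ.erase l, (1 - C (y i) * X))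

/-- The numerator `det (y_i^{ρ_j + r - j} (1 + b y_i)^{j-1})` of the bialternant formula. -/
def bialternantDet (b : A) (ρ : ℕ → ℕ) {r : ℕ} (y : Fin r → A) : A :=
  Matrix.det (Matrix.of fun i j : Fin r => y i ^ (ρ j + (r - (j + 1))) * (1 + b * y i) ^ (j : ℕ))

/-- Multiplying `h` by all factors but the `l`-th leaves the geometric series 1/(1 - y_l z). The
omitted product has degree less than `r`, so `r` terms give each of its coefficients. -/
theorem sum_intCoeff_mul_omittedMatrix {r : ℕ} {y : Fin r → A} {h : A⟦X⟧}
    (hh : h * ∏ i, (1 - C (y i) * X) = 1) (l : Fin r) (p : ℕ) :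
    ∑ j : Fin r, intCoeff h ((p : ℤ) - ((r - 1 - j : ℕ) : ℤ)) * omittedMatrix y j l = y l ^ p := by
  have hl := l.2
  have h1 : (h * ∏ i ∈ Finset.univ.erase l, (1 - C (y i) * X)) * (1 - C (y l) * X) = 1 := by
    rw [mul_assoc, Finset.prod_erase_mul _ _ (Finset.mem_univ l), hh]
  rw [← coeff_eq_pow_of_mul_eq_one h1, coeff_mul_eq_sum_intCoeff (r := r), Finset.sum_range,
    ← Equiv.sum_comp Fin.revPerm]
  · refine Finset.sum_congr rfl fun j _ => ?_
    rw [omittedMatrix, Matrix.of_apply, Fin.revPerm_apply, Fin.val_rev,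
      show r - 1 - (r - ((j : ℕ) + 1)) = j by omega]
  · intro n hn
    refine coeff_prod_one_sub_eq_zero _ _ ?_
    rw [Finset.card_erase_of_mem (Finset.mem_univ l), Finset.card_univ, Fintype.card_fin]
    omega

theorem jacobiTrudiDet_mul_det_omittedMatrix {r : ℕ} {y : Fin r → A} {h : A⟦X⟧}
    (hh : h * ∏ i, (1 - C (y i) * X) = 1) (b : A) (ρ : ℕ → ℕ) :
    jacobiTrudiDet b h ρ r * (omittedMatrix y).det = bialternantDet b ρ y := by
  rw [jacobiTrudiDet, ← Matrix.det_mul, bialternantDet, ← Matrix.det_transpose]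
  refine congrArg Matrix.det (Matrix.ext fun l i => ?_)
  rw [Matrix.transpose_apply, Matrix.mul_apply, Matrix.of_apply, ← sum_choose_mul_pow]
  simp only [jacobiTrudi, Matrix.of_apply, Finset.sum_mul]
  rw [Finset.sum_comm]
  refine Finset.sum_congr rfl fun m _ => ?_
  rw [← sum_intCoeff_mul_omittedMatrix hh, Finset.mul_sum]
  refine Finset.sum_congr rfl fun j _ => ?_
  rw [mul_assoc]
  congr 3
  have := i.2
  have := j.2
  -- Index match: (ρ_i + r - (i+1) + m) - (r-1-j) = ρ_i - (i+1) + m + (j+1).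
  omega

theorem bialternantDet_zero {r : ℕ} (y : Fin r → A) :
    bialternantDet 0 (fun _ => 0) y = ∏ i, ∏ j ∈ Finset.Ioi i, (y i - y j) := by
  have h := Matrix.det_projVandermonde (fun _ => (1 : A)) y
  simp only [one_mul] at h
  rw [← h, bialternantDet]
  refine congrArg Matrix.det (Matrix.ext fun i j => ?_)
  simp [Matrix.projVandermonde_apply, Fin.val_rev]

/-- The product formula is applied to b = 0 and ρ = 0: the first factor, with entries h_{j-i}, is
then upper unitriangular, and the bialternant numerator is the Vandermonde determinant. -/
theorem det_omittedMatrix {r : ℕ} {y : Fin r → A} {h : A⟦X⟧}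
    (hh : h * ∏ i, (1 - C (y i) * X) = 1) :
    (omittedMatrix y).det = ∏ i, ∏ j ∈ Finset.Ioi i, (y i - y j) := by
  have hentry : ∀ i j : Fin r,
      jacobiTrudi (0 : A) h (fun i => ((0 : ℕ) : ℤ) - ((i : ℤ) + 1)) r i j =
      intCoeff h ((j : ℤ) - i) := by
    intro i j
    rw [jacobiTrudi, Matrix.of_apply, Finset.sum_eq_single 0]
    · simp only [Nat.choose_zero_right, pow_zero, Nat.cast_one, one_mul, Nat.cast_zero]
      congr 1
      ring
    · intro m _ hm
      rw [zero_pow hm, mul_zero, zero_mul]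
    · simp
  have hh0 : intCoeff h 0 = 1 := by
    have := congrArg constantCoeff hh
    simpa [intCoeff] using this
  have h1 : jacobiTrudiDet 0 h (fun _ => 0) r = 1 := by
    rw [jacobiTrudiDet, Matrix.det_of_isUpperTriangular]
    · refine Finset.prod_eq_one fun i _ => ?_
      rw [hentry, sub_self, hh0]
    · intro i j hij
      have : (j : ℕ) < i := hij
      rw [hentry, intCoeff_of_neg h (by omega)]
  rw [← bialternantDet_zero, ← jacobiTrudiDet_mul_det_omittedMatrix hh, h1, one_mul]

theorem jacobiTrudiDet_mul_vandermonde {r : ℕ} {y : Fin r → A} {h : A⟦X⟧}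
    (hh : h * ∏ i, (1 - C (y i) * X) = 1) (b : A) (ρ : ℕ → ℕ) :
    jacobiTrudiDet b h ρ r * ∏ i, ∏ j ∈ Finset.Ioi i, (y i - y j) = bialternantDet b ρ y := by
  rw [← det_omittedMatrix hh, jacobiTrudiDet_mul_det_omittedMatrix hh]

/-- The row of the variable 0 is (0, …, 0, 1): its exponents ρ_j + r - j are positive for j < r, and
the last is ρ_r = 0. In the remaining rows the larger size costs one extra factor y_i. -/
theorem bialternantDet_snoc_zero (b : A) {ρ : ℕ → ℕ} {r : ℕ} (hρ : ρ r = 0) (y : Fin r → A) :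
    bialternantDet b ρ (Fin.snoc y 0 : Fin (r + 1) → A) = (∏ i, y i) * bialternantDet b ρ y := by
  rw [bialternantDet, Matrix.det_succ_row _ (Fin.last r), Finset.sum_eq_single (Fin.last r)]
  · rw [bialternantDet, ← Matrix.det_mul_column]
    have h1 : ((-1 : A) ^ ((Fin.last r : ℕ) + (Fin.last r : ℕ))) = 1 := by
      rw [← two_mul, pow_mul]; simp
    rw [h1, one_mul, Matrix.of_apply, Fin.snoc_last, Fin.val_last, hρ]
    simp only [Nat.sub_self, add_zero, pow_zero, mul_zero, one_pow, one_mul]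
    refine congrArg Matrix.det (Matrix.ext fun i j => ?_)
    have := j.2
    simp only [Matrix.submatrix_apply, Matrix.of_apply, Fin.succAbove_last, Fin.snoc_castSucc,
      Fin.val_castSucc]
    rw [← mul_assoc, ← pow_succ']
    congr 2
    omega
  · intro j _ hj
    have : (j : ℕ) < r := Fin.val_lt_last hj
    rw [Matrix.of_apply, Fin.snoc_last, zero_pow (by omega), zero_mul, mul_zero, zero_mul]
  · simp

theorem map_jacobiTrudiDet {B : Type*} [CommRing B] (f : A →+* B) (b : A) (h : A⟦X⟧) (ρ : ℕ → ℕ)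
    (r : ℕ) : f (jacobiTrudiDet b h ρ r) = jacobiTrudiDet (f b) (map f h) ρ r := by
  rw [jacobiTrudiDet, RingHom.map_det]
  refine congrArg Matrix.det (Matrix.ext fun i j => ?_)
  have hint : ∀ n, f (intCoeff h n) = intCoeff (map f h) n := fun n => by
    unfold intCoeff
    split_ifs <;> simp
  simp [jacobiTrudi, hint]

theorem prod_one_sub_snoc_zero {r : ℕ} (y : Fin r → A) :
    ∏ i, (1 - C ((Fin.snoc y 0 : Fin (r + 1) → A) i) * X : A⟦X⟧) = ∏ i, (1 - C (y i) * X) := by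
  rw [Fin.prod_univ_castSucc]
  simp

/-- The inverse of `∏_i (1 - y_i z)`. -/
def completeSeries {ι : Type*} [Fintype ι] (y : ι → A) : A⟦X⟧ :=
  invOfUnit (∏ i, (1 - C (y i) * X)) 1

theorem completeSeries_mul {ι : Type*} [Fintype ι] (y : ι → A) :
    completeSeries y * ∏ i, (1 - C (y i) * X) = 1 := by
  rw [mul_comm]
  exact mul_invOfUnit _ _ (by simp)

theorem map_prod_one_sub {B ι : Type*} [CommRing B] [Fintype ι] (f : A →+* B) (y : ι → A) :
    map f (∏ i, (1 - C (y i) * X)) = ∏ i, (1 - C (f (y i)) * X) := by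
  simp [map_prod]

theorem map_completeSeries {B ι : Type*} [CommRing B] [Fintype ι] (f : A →+* B) {y : ι → A}
    {h : B⟦X⟧} (hh : h * ∏ i, (1 - C (f (y i)) * X) = 1) : map f (completeSeries y) = h := by
  have h1 := congrArg (map f) (completeSeries_mul y)
  rw [map_mul, map_prod_one_sub, map_one] at h1
  linear_combination h * h1 - map f (completeSeries y) * hh

theorem vandermonde_X_ne_zero (k : Type*) [Field k] (r : ℕ) :
    ∏ i : Fin r, ∏ j ∈ Finset.Ioi i,
      (MvPolynomial.X i - MvPolynomial.X j : MvPolynomial (Fin r) k) ≠ 0 := by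
  refine Finset.prod_ne_zero_iff.mpr fun i _ => Finset.prod_ne_zero_iff.mpr fun j hj => ?_
  rw [sub_ne_zero]
  exact fun h => (Finset.mem_Ioi.mp hj).ne (MvPolynomial.X_injective h)

/-- Appending a variable 0 does not change `h`, and it multiplies numerator and Vandermonde product
by ∏ y_i. For indeterminates, all these factors are nonzero in a domain and cancel. -/
theorem jacobiTrudiDet_succ_generic {k : Type*} [Field k] (β : k) {ρ : ℕ → ℕ} {r : ℕ}
    (hρ : ρ r = 0) :
    jacobiTrudiDet (MvPolynomial.C β)
        (completeSeries (MvPolynomial.X : Fin r → MvPolynomial (Fin r) k)) ρ (r + 1) =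
      jacobiTrudiDet (MvPolynomial.C β) (completeSeries MvPolynomial.X) ρ r := by
  set y : Fin r → MvPolynomial (Fin r) k := MvPolynomial.X
  have h1 := jacobiTrudiDet_mul_vandermonde (completeSeries_mul y) (MvPolynomial.C β) ρ
  have h2 := jacobiTrudiDet_mul_vandermonde (y := (Fin.snoc y 0 : Fin (r + 1) → _))
    (h := completeSeries y) (by rw [prod_one_sub_snoc_zero, completeSeries_mul])
    (MvPolynomial.C β) ρ
  rw [bialternantDet_snoc_zero _ hρ, ← h1, ← bialternantDet_zero, bialternantDet_snoc_zero _ rfl,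
    bialternantDet_zero, mul_left_comm] at h2
  have h3 : ∏ i, y i ≠ 0 := Finset.prod_ne_zero_iff.mpr fun i _ => MvPolynomial.X_ne_zero i
  exact mul_right_cancel₀ (vandermonde_X_ne_zero k r) (mul_left_cancel₀ h3 h2)

/-- Obtained by evaluating the generic identity at `y`: direct cancellation fails once some y_i is
0, as happens after the first enlargement. -/
theorem jacobiTrudiDet_succ {k : Type*} [Field k] [Algebra k A] (β : k) {ρ : ℕ → ℕ} {r : ℕ}
    (hρ : ρ r = 0) {y : Fin r → A} {h : A⟦X⟧} (hh : h * ∏ i, (1 - C (y i) * X) = 1) :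
    jacobiTrudiDet (algebraMap k A β) h ρ (r + 1) = jacobiTrudiDet (algebraMap k A β) h ρ r := by
  have h1 := congrArg (MvPolynomial.aeval y).toRingHom (jacobiTrudiDet_succ_generic β hρ)
  rw [map_jacobiTrudiDet, map_jacobiTrudiDet,
    map_completeSeries (h := h) _ (by simpa using hh)] at h1
  simpa using h1

theorem jacobiTrudiDet_eq_of_le {k : Type*} [Field k] [Algebra k A] (β : k) {ρ : ℕ → ℕ} {n r : ℕ}
    (hnr : n ≤ r) (hρ : ∀ i, n ≤ i → ρ i = 0) {y : Fin n → A} {h : A⟦X⟧}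
    (hh : h * ∏ i, (1 - C (y i) * X) = 1) :
    jacobiTrudiDet (algebraMap k A β) h ρ r = jacobiTrudiDet (algebraMap k A β) h ρ n := by
  have key : (∃ y : Fin r → A, h * ∏ i, (1 - C (y i) * X) = 1) ∧
      jacobiTrudiDet (algebraMap k A β) h ρ r = jacobiTrudiDet (algebraMap k A β) h ρ n := by
    induction r, hnr using Nat.le_induction with
    | base => exact ⟨⟨y, hh⟩, rfl⟩
    | succ r hr ih =>
      obtain ⟨⟨y', hy'⟩, ih⟩ := ih
      exact ⟨⟨Fin.snoc y' 0, by rw [prod_one_sub_snoc_zero, hy']⟩,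
        (jacobiTrudiDet_succ β (hρ r hr) hy').trans ih⟩
  exact key.2

theorem derivative_prod_one_sub {ι : Type*} (s : Finset ι) (y : ι → A) (u : ι → A⟦X⟧)
    (hu : ∀ i, u i * (1 - C (y i) * X) = C (y i)) :
    d⁄dX A (∏ i ∈ s, (1 - C (y i) * X)) + (∑ i ∈ s, u i) * ∏ i ∈ s, (1 - C (y i) * X) = 0 := by
  classical
  induction s using Finset.induction_on with
  | empty => simp
  | insert i s hi ih =>
    have h1 : d⁄dX A (1 - C (y i) * X) = -C (y i) := by
      rw [map_sub, derivative_one, Derivation.leibniz, derivative_C, derivative_X]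
      simp
    rw [Finset.prod_insert hi, Finset.sum_insert hi, Derivation.leibniz, h1, smul_eq_mul,
      smul_eq_mul]
    linear_combination (1 - C (y i) * X) * ih + (∏ i ∈ s, (1 - C (y i) * X)) * hu i

/-- Here c' = ∑ y_i/(1 - y_i z) is minus the logarithmic derivative of the product, so the
differential equation forces e^c to be its inverse. -/
theorem expSeries_mul_prod_one_sub [Algebra ℚ A] {ι : Type*} [Fintype ι] (y : ι → A) {c : A⟦X⟧}
    (hc : constantCoeff c = 0)
    (hy : ∀ m : ℕ, coeff (m + 1) c * ((m + 1 : ℕ) : A) = ∑ i, y i ^ (m + 1)) :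
    expSeries c * ∏ i, (1 - C (y i) * X) = 1 := by
  refine expSeries_mul_eq_one hc (by simp) ?_
  have h1 : d⁄dX A c = ∑ i, PowerSeries.mk fun m => y i ^ (m + 1) := by
    ext m
    rw [coeff_derivative, map_sum, ← Nat.cast_succ, hy]
    simp only [coeff_mk]
  rw [h1]
  refine derivative_prod_one_sub _ y _ fun i => ?_
  ext m
  rw [mul_sub, mul_one, mul_left_comm, map_sub, coeff_C_mul, coeff_mk, coeff_C]
  rcases m with _ | m
  · simp
  · rw [coeff_succ_mul_X, coeff_mk, if_neg m.succ_ne_zero]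
    ring

end Bialternant

/-! ### Specialization to finitely many variables -/

section Specialization

open PowerSeries

variable {k : Type*} [Field k]

theorem killCompl_powerSum (n m : ℕ) :
    MvPowerSeries.killCompl Fin.valEmbedding (powerSum (k := k) (m + 1)) =
      ∑ i : Fin n, (MvPowerSeries.X i : MvPowerSeries (Fin n) k) ^ (m + 1) := by
  classical
  refine MvPowerSeries.ext fun d => ?_
  rw [MvPowerSeries.coeff_killCompl, map_sum]
  simp only [MvPowerSeries.coeff_X_pow]
  have h1 : MvPowerSeries.coeff (Finsupp.embDomain Fin.valEmbedding d) (powerSum (k := k) (m + 1)) =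
      if ∃ i : ℕ, Finsupp.embDomain Fin.valEmbedding d = Finsupp.single i (m + 1) then 1
      else 0 := by
    unfold powerSum
    exact if_congr Iff.rfl rfl rfl
  rw [h1]
  split_ifs with h
  · obtain ⟨i, hi⟩ := h
    -- The extended exponent vanishes off the first `n` variables, whereas m + 1 ≠ 0.
    have hi' : i ∈ Set.range (Fin.valEmbedding : Fin n ↪ ℕ) := by
      by_contra hr
      have := Finsupp.embDomain_of_notMem_range Fin.valEmbedding d i hr
      rw [hi, Finsupp.single_eq_same] at this
      omega
    obtain ⟨j, rfl⟩ := hi'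
    rw [← Finsupp.embDomain_single, Finsupp.embDomain_inj] at hi
    rw [Finset.sum_eq_single j, if_pos hi]
    · intro l _ hl
      rw [if_neg]
      rintro rfl
      exact hl ((Finsupp.single_left_inj m.succ_ne_zero).mp hi)
    · simp
  · symm
    refine Finset.sum_eq_zero fun i _ => ?_
    rw [if_neg]
    intro hd
    refine h ⟨i, ?_⟩
    rw [hd, Finsupp.embDomain_single]
    rfl

theorem coe_jacobiTrudiDet (β : k) (ρ : ℕ → ℕ) (n : ℕ) :
    ((jacobiTrudiDet (MvPolynomial.C β)
      (completeSeries (MvPolynomial.X : Fin n → MvPolynomial (Fin n) k)) ρ n :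
        MvPolynomial (Fin n) k) : MvPowerSeries (Fin n) k) =
      jacobiTrudiDet (algebraMap k _ β) (completeSeries MvPowerSeries.X) ρ n := by
  have h : ∀ i : Fin n, MvPolynomial.coeToMvPowerSeries.ringHom (MvPolynomial.X i) =
      (MvPowerSeries.X i : MvPowerSeries (Fin n) k) := fun i => MvPolynomial.coe_X i
  refine (map_jacobiTrudiDet
    (MvPolynomial.coeToMvPowerSeries.ringHom : MvPolynomial (Fin n) k →+* MvPowerSeries (Fin n) k)
    _ _ _ _).trans ?_
  rw [map_completeSeries (h := completeSeries MvPowerSeries.X) _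
    (by simp only [h]; exact completeSeries_mul _)]
  exact congrArg (jacobiTrudiDet · _ ρ n) (MvPolynomial.coe_C β)

variable [CharZero k]

/-- The determinant involves the variables only through power sums, so the values of κ on these
suffice; they identify the image of `h` with the inverse of ∏(1 - y_i z). -/
theorem map_fermionicG {B : Type*} [CommRing B] [Algebra k B] [Algebra ℚ B]
    (κ : MvPowerSeries ℕ k →ₐ[k] B) {n : ℕ} {y : Fin n → B}
    (hκ : ∀ m : ℕ, κ (powerSum (m + 1)) = ∑ i, y i ^ (m + 1)) (β : k) {lam : YoungDiagram} {r : ℕ}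
    (hn : lam.rowLens.length ≤ n) (hr : n ≤ r) :
    κ (fermionicG β lam r) =
      jacobiTrudiDet (algebraMap k B β) (completeSeries y) lam.rowLen n := by
  have hc : constantCoeff (map κ.toRingHom (powerSumSeries k)) = 0 := by
    rw [← coeff_zero_eq_constantCoeff_apply, coeff_map, coeff_zero_eq_constantCoeff_apply,
      constantCoeff_powerSumSeries, map_zero]
  have hE := expSeries_mul_prod_one_sub y hc fun m => by
    have hm : ((m + 1 : ℕ) : k) ≠ 0 := Nat.cast_ne_zero.mpr m.succ_ne_zero
    rw [coeff_map, coeff_powerSumSeries, ← hκ m]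
    change κ (((m + 1 : ℕ) : k)⁻¹ • powerSum (m + 1)) * _ = κ (powerSum (m + 1))
    rw [map_smul, smul_mul_assoc, mul_comm, ← nsmul_eq_mul, ← Nat.cast_smul_eq_nsmul k, smul_smul,
      inv_mul_cancel₀ hm, one_smul]
  have hρ : ∀ i, n ≤ i → lam.rowLen i = 0 := fun i hi => by
    rw [YoungDiagram.length_rowLens] at hn
    by_contra h
    have h1 := YoungDiagram.mem_iff_lt_rowLen.mpr (Nat.pos_of_ne_zero h)
    have := YoungDiagram.mem_iff_lt_colLen.mp h1
    omega
  have h1 : κ.toRingHom (algebraMap k _ β) = algebraMap k _ β := κ.commutes β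
  have h2 : expSeries (map κ.toRingHom (powerSumSeries k)) = completeSeries y := by
    linear_combination (-expSeries (map κ.toRingHom (powerSumSeries k))) * completeSeries_mul y +
      completeSeries y * hE
  refine (congrArg κ.toRingHom (fermionicG_eq_det β lam r)).trans ?_
  have h3 := map_expSeries κ.toRingHom (constantCoeff_powerSumSeries (k := k))
  rw [map_jacobiTrudiDet, h3, h1, h2,
    jacobiTrudiDet_eq_of_le β hr hρ (completeSeries_mul y)]

theorem specialize_fermionicG (β : k) (lam : YoungDiagram) (n r : ℕ)
    (hn : lam.rowLens.length ≤ n) (hr : n ≤ r) :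
    specialize n (fermionicG β lam r) = ((jacobiTrudiDet (MvPolynomial.C β)
      (completeSeries (MvPolynomial.X : Fin n → MvPolynomial (Fin n) k)) lam.rowLen n :
        MvPolynomial (Fin n) k) : MvPowerSeries (Fin n) k) :=
  (map_fermionicG (MvPowerSeries.killCompl Fin.valEmbedding) (killCompl_powerSum n) β hn hr).trans
    (coe_jacobiTrudiDet β lam.rowLen n).symm

end Specialization

theorem algebraMap_jacobiTrudiDet_eq_bialternantG {k : Type*} [Field k] (β : k)
    (lam : YoungDiagram) (n : ℕ) :
    algebraMap (MvPolynomial (Fin n) k) (FractionRing (MvPolynomial (Fin n) k))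
        (jacobiTrudiDet (MvPolynomial.C β) (completeSeries MvPolynomial.X) lam.rowLen n) =
      bialternantG β lam n := by
  have hV := (map_ne_zero_iff (algebraMap (MvPolynomial (Fin n) k)
    (FractionRing (MvPolynomial (Fin n) k))) (IsFractionRing.injective _ _)).mpr
      (vandermonde_X_ne_zero k n)
  rw [bialternantG, eq_div_iff hV, ← map_mul,
    jacobiTrudiDet_mul_vandermonde (completeSeries_mul MvPolynomial.X)]
  rfl

end FreeFermion

end

/-- If `ℓ(λ) ≤ n ≤ r`, then `G_λ(x₁, …, x_n)`, given by the bialternant formula, is a polynomial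
and equals `G^r_λ(x₁, …, x_n, 0, 0, …)`. -/
theorem mainTheorem2 {k : Type*} [Field k] [CharZero k] (β : k) (lam : YoungDiagram) (n r : ℕ)
    (hn : lam.rowLens.length ≤ n) (hr : n ≤ r) :
    ∃ g : MvPolynomial (Fin n) k,
      algebraMap (MvPolynomial (Fin n) k) (FractionRing (MvPolynomial (Fin n) k)) g =
          FreeFermion.bialternantG β lam n ∧
        FreeFermion.specialize n (FreeFermion.fermionicG β lam r) =
          (g : MvPowerSeries (Fin n) k) :=
  ⟨_, FreeFermion.algebraMap_jacobiTrudiDet_eq_bialternantG β lam n,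
    FreeFermion.specialize_fermionicG β lam n r hn hr⟩
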